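/- Conventions. Manifolds are Hausdorff and second countable. Let $(N,J)$ be a complex manifold. A Hermitian metric on $N$ is a smooth Riemannian metric $g$ with $g(JX,JY)=g(X,Y)$; its fundamental form is $\Omega(X,Y)=g(JX,Y)$, and $g$ is Kähler if $d\Omega=0$. The conformal class $[g]$ consists of the metrics $e^{\alpha}g$ with $\alpha\in C^\infty(N)$. Assume $\dim_{\mathbb C}N\ge 2$. Then $[g]$ (or $(N,[g],J)$) is locally conformal Kähler if every point of $N$ has an open neighbourhood $U$ with a smooth function $\alpha$ on $U$ such that $e^{\alpha}g|_U$ is Kähler, and globally conformal Kähler if $[g]$ contains a Kähler metric. An automorphism of $(N,[g],J)$ is a biholomorphism $\varphi$ of $N$ with $[\varphi^*g]=[g]$. A homothety of a Kähler manifold $(K,k,J)$ is a biholomorphism $\varphi$ of $K$ with $\varphi^*k=\lambda k$ for a constant $\lambda>0$; its dilation factor is $\rho(\varphi)=\lambda$. Statement. Let $(\tilde M,[\tilde g],J)$ be a globally conformal Kähler manifold with $\dim_{\mathbb C}\tilde M\ge 2$, and let $\Gamma$ be a group of automorphisms of $(\tilde M,[\tilde g],J)$ acting freely and properly discontinuously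 on $\tilde M$ (for compact $K,L\subset\tilde M$ only finitely many $\gamma\in\Gamma$ satisfy $\gamma K\cap L\ne\emptyset$). Let $p:\tilde M\to M=\tilde M/\Gamma$ be the projection. Then $M$, with its naturally induced complex structure (for which $p$ is locally biholomorphic), is a complex manifold, and it carries a locally conformal Kähler structure $[g]$ with $[p^*g]=[\tilde g]$. This structure is unique: every Hermitian metric $g'$ on $M$ with $[p^*g']=[\tilde g]$ satisfies $[g']=[g]$. Assume moreover that $\tilde M$ is connected and that $\Gamma$ consists of homotheties with respect to the Kähler metrics in $[\tilde g]$. Then $(M,[g],J)$ is globally conformal Kähler if and only if $\rho(\Gamma)=1$, i.e. every $\gamma\in\Gamma$ has dilation factor $1$. -/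

import Mathlib

open scoped Manifold ContDiff Topology

noncomputable section

namespace LCK

/-! ### Complex manifolds and their biholomorphisms

A complex manifold is a manifold `M` modelled on a finite-dimensional complex vector space `E`, with
`IsManifold 𝓘(ℂ, E) ω M`. The same charts make it a smooth real manifold, with model `𝓘(ℝ, E)`. -/

section Manifold

variable {E : Type*} [NormedAddCommGroup E] [NormedSpace ℂ E]
  {M : Type*} [TopologicalSpace M] [ChartedSpace E M]

/-- The smooth real manifold underlying a complex manifold. -/
instance isManifold_real [IsManifold 𝓘(ℂ, E) ω M] : IsManifold 𝓘(ℝ, E) ω M := by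
  refine isManifold_of_contDiffOn 𝓘(ℝ, E) ω M fun e e' he he' => ?_
  have h : ContDiffOn ℂ ω (𝓘(ℂ, E) ∘ e.symm ≫ₕ e' ∘ 𝓘(ℂ, E).symm)
      (𝓘(ℂ, E).symm ⁻¹' (e.symm ≫ₕ e').source ∩ Set.range 𝓘(ℂ, E)) :=
    ((contDiffGroupoid ω 𝓘(ℂ, E)).compatible he he').1
  exact h.restrict_scalars ℝ

variable (E M) in
/-- The biholomorphic maps of a complex manifold onto itself. -/
abbrev Biholomorphism : Type _ := Diffeomorph 𝓘(ℂ, E) 𝓘(ℂ, E) M M ω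

instance : Group (Biholomorphism E M) where
  mul φ ψ := ψ.trans φ
  one := Diffeomorph.refl 𝓘(ℂ, E) M ω
  inv φ := φ.symm
  mul_assoc _ _ _ := rfl
  one_mul _ := rfl
  mul_one _ := rfl
  inv_mul_cancel φ := Diffeomorph.ext fun x => φ.symm_apply_apply x

instance : MulAction (Biholomorphism E M) M where
  smul φ x := φ x
  one_smul _ := rfl
  mul_smul _ _ _ := rfl

instance : ContinuousConstSMul (Biholomorphism E M) M where
  continuous_const_smul φ := φ.continuous

instance (Γ : Subgroup (Biholomorphism E M)) : ContinuousConstSMul Γ M where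
  continuous_const_smul γ := γ.1.continuous

end Manifold

/-! ### The quotient by a free and properly discontinuous group of biholomorphisms -/

section Quotient

open MulAction

variable {E : Type*} [NormedAddCommGroup E] [NormedSpace ℂ E]
  {M : Type*} [TopologicalSpace M] [ChartedSpace E M]

/-- The projection onto the space of orbits. -/
abbrev proj (Γ : Subgroup (Biholomorphism E M)) (x : M) : orbitRel.Quotient Γ M :=
  Quotient.mk (orbitRel Γ M) x

variable [FiniteDimensional ℂ E] [T2Space M] (Γ : Subgroup (Biholomorphism E M))
  [IsCancelSMul Γ M] [ProperlyDiscontinuousSMul Γ M]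

theorem isLocalHomeomorph_proj : IsLocalHomeomorph (proj Γ) :=
  haveI : ProperSpace E := FiniteDimensional.proper ℂ E
  haveI : LocallyCompactSpace M := ChartedSpace.locallyCompactSpace E M
  isQuotientCoveringMap_quotientMk_of_properlyDiscontinuousSMul.isCoveringMap.isLocalHomeomorph

/-- The naturally induced charts of the quotient: local inverses of the projection, followed by the
charts of `M`. -/
instance quotientChartedSpace : ChartedSpace E (orbitRel.Quotient Γ M) :=
  haveI : ProperSpace E := FiniteDimensional.proper ℂ E
  haveI : LocallyCompactSpace M := ChartedSpace.locallyCompactSpace E M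
  MulAction.instChartedSpaceQuotient

theorem exists_chart_eq {e : OpenPartialHomeomorph (orbitRel.Quotient Γ M) E}
    (he : e ∈ atlas E (orbitRel.Quotient Γ M)) :
    ∃ x : M, e = ((isLocalHomeomorph_proj Γ).localInverseAt x).trans (chartAt E x) := by
  obtain ⟨q, hq⟩ := he
  exact ⟨_, hq.symm⟩

/-- The quotient is a complex manifold. -/
instance quotientIsManifold [IsManifold 𝓘(ℂ, E) ω M] :
    IsManifold 𝓘(ℂ, E) ω (orbitRel.Quotient Γ M) := by
  refine isManifold_of_contDiffOn 𝓘(ℂ, E) ω _ fun e e' he he' => ?_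
  obtain ⟨a, rfl⟩ := exists_chart_eq Γ he
  obtain ⟨b, rfl⟩ := exists_chart_eq Γ he'
  have hp := isLocalHomeomorph_proj Γ
  intro y hy
  simp only [modelWithCornersSelf_coe, modelWithCornersSelf_coe_symm, Set.range_id, Set.inter_univ,
    Set.preimage_id, Function.comp_id, Function.id_comp] at hy ⊢
  simp only [OpenPartialHomeomorph.trans_source, OpenPartialHomeomorph.symm_source,
    OpenPartialHomeomorph.trans_target, Set.mem_inter_iff, Set.mem_preimage,
    OpenPartialHomeomorph.coe_trans_symm, Function.comp_apply,
    IsLocalHomeomorph.localInverseAt_symm] at hy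
  obtain ⟨⟨hy1, hy2⟩, hy3, hy4⟩ := hy
  set x := (chartAt E a).symm y with hx
  set σ := hp.localInverseAt b with hσ
  have hrel : proj Γ (σ (proj Γ x)) = proj Γ x := hp.apply_localInverseAt_of_mem hy3
  obtain ⟨γ, hγ⟩ := Quotient.exact hrel
  replace hγ : γ • x = σ (proj Γ x) := hγ
  have hγt : γ • x ∈ σ.target := hγ ▸ σ.map_source hy3
  have hγc : γ • x ∈ (chartAt E b).source := hγ ▸ hy4
  have hcγ : Continuous fun z : M => γ • z := continuous_const_smul γ
  have hcx : ContinuousAt (chartAt E a).symm y := (chartAt E a).continuousAt_symm hy1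
  have hev : ∀ᶠ z in 𝓝 x, σ (proj Γ z) = γ • z := by
    filter_upwards [hcγ.continuousAt.preimage_mem_nhds (σ.open_target.mem_nhds hγt)] with z hz
    have h1 : proj Γ z = proj Γ (γ • z) := Quotient.sound ⟨γ⁻¹, inv_smul_smul γ z⟩
    have h2 : proj Γ (γ • z) = σ.symm (γ • z) := by
      rw [hσ, hp.localInverseAt_symm]
    rw [h1, h2]
    exact σ.right_inv hz
  have hγm : ContMDiff 𝓘(ℂ, E) 𝓘(ℂ, E) ω fun z : M => γ • z := γ.1.contMDiff
  have h3 : ContMDiffAt 𝓘(ℂ, E) 𝓘(ℂ, E) ω (fun z => chartAt E b (γ • (chartAt E a).symm z)) y :=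
    (contMDiffAt_of_mem_maximalAtlas (IsManifold.chart_mem_maximalAtlas b) hγc).comp y
      (hγm.contMDiffAt.comp y (contMDiffOn_symm_of_mem_maximalAtlas
        (IsManifold.chart_mem_maximalAtlas a) |>.contMDiffAt
          ((chartAt E a).open_target.mem_nhds hy1)))
  refine (h3.contDiffAt.congr_of_eventuallyEq ?_).contDiffWithinAt
  filter_upwards [hcx.eventually hev] with z hz
  simp only [OpenPartialHomeomorph.coe_trans, OpenPartialHomeomorph.coe_trans_symm,
    Function.comp_apply, IsLocalHomeomorph.localInverseAt_symm]
  rw [← hz]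

end Quotient

/-! ### Hermitian, Kähler and locally conformal Kähler metrics -/

section Tensor

variable (E : Type*) [NormedAddCommGroup E] [NormedSpace ℂ E]
  (M : Type*) [TopologicalSpace M] [ChartedSpace E M]

/-- Fields of (continuous) real bilinear forms on the real tangent spaces of `M`. -/
abbrev BilinField : Type _ :=
  ∀ x : M, TangentSpace 𝓘(ℝ, E) x →L[ℝ] TangentSpace 𝓘(ℝ, E) x →L[ℝ] ℝ

variable {E M}

/-- The complex structure `J` of the real tangent space: in the charts of `M`, it is the
multiplication by `i` of `E`. -/
def complexStructure (x : M) : TangentSpace 𝓘(ℝ, E) x →L[ℝ] TangentSpace 𝓘(ℝ, E) x :=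
  (Complex.I • ContinuousLinearMap.id ℝ E : E →L[ℝ] E)

variable {E' : Type*} [NormedAddCommGroup E'] [NormedSpace ℂ E']
  {N : Type*} [TopologicalSpace N] [ChartedSpace E' N]

/-- The pull-back `f^* T`, namely `(f^* T)(v, w) = T(df v, df w)`. -/
def pullback (f : M → N) (T : BilinField E' N) : BilinField E M := fun x =>
  let A := mfderiv 𝓘(ℝ, E) 𝓘(ℝ, E') f x
  (ContinuousLinearMap.precomp ℝ A).comp ((T (f x)).comp A)

/-- `T` and `T'` are (globally) conformal: `T' = e^α T` for a smooth function `α`. -/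
def ConformalTo (T T' : BilinField E M) : Prop :=
  ∃ α : M → ℝ, ContMDiff 𝓘(ℝ, E) 𝓘(ℝ, ℝ) ∞ α ∧ ∀ x, T' x = Real.exp (α x) • T x

/-- The exterior derivative at `x` of a field `Ω` of alternating bilinear forms, computed in the
chart at `x` (where the tangent space at `x` is `E`):
`dΩ(u, v, w) = ∂_u Ω(v, w) - ∂_v Ω(u, w) + ∂_w Ω(u, v)`. -/
def extDerivForm (Ω : BilinField E M) (x : M) (u v w : E) : ℝ :=
  let coeff : E → E → E → ℝ := fun a b y => pullback (chartAt E x).symm Ω y a b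
  let y := chartAt E x x
  fderiv ℝ (coeff v w) y u - fderiv ℝ (coeff u w) y v + fderiv ℝ (coeff u v) y w

/-- The fundamental form `Ω(X, Y) = g(JX, Y)`. -/
def fundamentalForm (g : BilinField E M) : BilinField E M := fun x =>
  (g x).comp (complexStructure x)

end Tensor

section Metric

variable (E : Type*) [NormedAddCommGroup E] [NormedSpace ℂ E]
  (M : Type*) [TopologicalSpace M] [ChartedSpace E M] [IsManifold 𝓘(ℂ, E) ω M]

/-- A Hermitian metric on a complex manifold: a smooth Riemannian metric `g` on the underlying real
manifold with `g(JX, JY) = g(X, Y)`. -/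
structure HermitianMetric extends
    Bundle.ContMDiffRiemannianMetric 𝓘(ℝ, E) ∞ E (fun x : M => TangentSpace 𝓘(ℝ, E) x) where
  hermitian (x : M) (v w : TangentSpace 𝓘(ℝ, E) x) :
    inner x (complexStructure x v) (complexStructure x w) = inner x v w

variable {E M}

/-- The metric as a field of bilinear forms. -/
abbrev HermitianMetric.form (g : HermitianMetric E M) : BilinField E M := g.inner

/-- `g` is Kähler: its fundamental form is closed. -/
def HermitianMetric.IsKahler (g : HermitianMetric E M) : Prop :=
  ∀ (x : M) (u v w : E), extDerivForm (fundamentalForm g.form) x u v w = 0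

/-- `g` is locally conformal Kähler: around every point there is a smooth function `α` such that
`e^α g` is Kähler. -/
def HermitianMetric.IsLCK (g : HermitianMetric E M) : Prop :=
  ∀ x₀ : M, ∃ U : Set M, IsOpen U ∧ x₀ ∈ U ∧ ∃ α : M → ℝ,
    ContMDiffOn 𝓘(ℝ, E) 𝓘(ℝ, ℝ) ∞ α U ∧
    ∀ x ∈ U, ∀ u v w : E,
      extDerivForm (fundamentalForm fun y => Real.exp (α y) • g.form y) x u v w = 0

/-- `g` is globally conformal Kähler: its conformal class contains a Kähler metric. -/
def HermitianMetric.IsGCK (g : HermitianMetric E M) : Prop :=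
  ∃ k : HermitianMetric E M, k.IsKahler ∧ ConformalTo g.form k.form

/-- The biholomorphism `φ` is an automorphism of `(M, [g], J)`: `[φ^* g] = [g]`. -/
def HermitianMetric.IsAutomorphism (g : HermitianMetric E M) (φ : Biholomorphism E M) : Prop :=
  ConformalTo (pullback φ g.form) g.form

/-- The biholomorphism `φ` is a homothety of `k` of dilation factor `c`: `φ^* k = c k`. -/
def HermitianMetric.HasDilationFactor (k : HermitianMetric E M) (φ : Biholomorphism E M) (c : ℝ) :
    Prop :=
  0 < c ∧ ∀ x, pullback φ k.form x = c • k.form x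

/-- `φ` is a homothety of `k`. -/
def HermitianMetric.IsHomothety (k : HermitianMetric E M) (φ : Biholomorphism E M) : Prop :=
  ∃ c : ℝ, k.HasDilationFactor φ c

open Classical in
/-- The dilation factor `ρ(φ)` of a homothety `φ` of `k`. -/
def HermitianMetric.dilationFactor (k : HermitianMetric E M) (φ : Biholomorphism E M) : ℝ :=
  if h : k.IsHomothety φ then h.choose else 1

theorem HermitianMetric.HasDilationFactor.dilationFactor_eq [Nonempty M] [Nontrivial E]
    {k : HermitianMetric E M} {φ : Biholomorphism E M} {c : ℝ} (h : k.HasDilationFactor φ c) :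
    k.dilationFactor φ = c := by
  have h' : k.IsHomothety φ := ⟨c, h⟩
  have h1 := h'.choose_spec
  rw [dilationFactor, dif_pos h']
  obtain ⟨x⟩ := ‹Nonempty M›
  obtain ⟨v, hv⟩ := exists_ne (0 : E)
  have h2 := (h1.2 x).symm.trans (h.2 x)
  have h3 := congrArg (fun B => B v v) h2
  have h4 : h'.choose * k.form x v v = c * k.form x v v := h3
  exact mul_right_cancel₀ (k.pos x v hv).ne' h4

end Metric

end LCK

end

open LCK

/-! The projection `p` is a local biholomorphism whose local inverses differ by elements of `Γ`, so
a metric on the quotient is the same as a `Γ`-invariant metric upstairs. The given metric is only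
conformally invariant. Pulling it back by local inverses of `p` therefore gives local Hermitian
metrics on the quotient that agree up to positive factors. The forms whose pull-backs are positive
multiples of the given metric form a convex set at each point, so a partition of unity glues these
local metrics into `g` (`exists_hermitianMetric_quotient`). Pointwise proportional metrics are
conformal with a smooth factor (`conformalTo_of_formAt`), and pull-back by `p` is injective on
forms; this gives uniqueness.

Closedness passes through `p` in both directions, because `d` commutes with pull-back and
holomorphic maps respect `J` (`extDerivForm_fundamentalForm_pullback_eq_zero`). If `k = e^f p^*g` is
Kähler and `s` is a local inverse of `p`, then `e^(f ∘ s) g` is Kähler near the given point, so `g`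
is locally conformal Kähler.

If all dilation factors are 1, then `k` and `p^*g` are both invariant, hence so is `f`, which
descends to a global conformal factor. Conversely, let `k'` be Kähler in `[g]`. Then `p^*k'` and `k`
are conformal Kähler metrics on a connected manifold, with `p^*k' = e^α k`. Closedness leaves
`d(e^α) ∧ Ω = 0`, and wedging with `Ω` is injective on 1-forms in complex dimension at least 2, so
`e^α` is constant (`exp_eq_of_isKahler`). As `p^*k'` is invariant under `Γ`, so is `k`.

All tangent spaces are by definition the model space `E`; `formAt` and `diffAt` fix this type, so
that base points can be rewritten freely. -/

noncomputable section

namespace LCK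

/-! ### Exterior derivative of bilinear fields on a vector space -/

section Linear

variable {V W X : Type*} [NormedAddCommGroup V] [NormedSpace ℝ V] [NormedAddCommGroup W]
  [NormedSpace ℝ W] [NormedAddCommGroup X] [NormedSpace ℝ X]

/-- The pull-back of a continuous bilinear form by a continuous linear map. -/
def bilinComp (B : W →L[ℝ] W →L[ℝ] ℝ) (A : V →L[ℝ] W) : V →L[ℝ] V →L[ℝ] ℝ :=
  (ContinuousLinearMap.precomp ℝ A).comp (B.comp A)

@[simp]
theorem bilinComp_apply (B : W →L[ℝ] W →L[ℝ] ℝ) (A : V →L[ℝ] W) (v w : V) :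
    bilinComp B A v w = B (A v) (A w) := rfl

theorem bilinComp_bilinComp (B : X →L[ℝ] X →L[ℝ] ℝ) (A : W →L[ℝ] X) (A' : V →L[ℝ] W) :
    bilinComp (bilinComp B A) A' = bilinComp B (A.comp A') := rfl

theorem _root_.ContDiffAt.bilinComp {n : WithTop ℕ∞} {B : X → W →L[ℝ] W →L[ℝ] ℝ}
    {A : X → V →L[ℝ] W} {x : X} (hB : ContDiffAt ℝ n B x) (hA : ContDiffAt ℝ n A x) :
    ContDiffAt ℝ n (fun y => bilinComp (B y) (A y)) x := by
  have hc := ContinuousLinearMap.contDiff (𝕜 := ℝ) (n := n) (E := V →L[ℝ] W)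
    (F := (W →L[ℝ] ℝ) →L[ℝ] V →L[ℝ] ℝ) (ContinuousLinearMap.compL ℝ V W ℝ).flip
  have h : ContDiffAt ℝ n (fun y => (ContinuousLinearMap.precomp ℝ (A y) :
      (W →L[ℝ] ℝ) →L[ℝ] V →L[ℝ] ℝ)) x := hc.contDiffAt.comp x hA
  exact h.clm_comp (hB.clm_comp hA)

/-- The exterior derivative, at a point of a vector space, of a field of bilinear forms. -/
def flatExtDeriv (B : V → V →L[ℝ] V →L[ℝ] ℝ) (y u v w : V) : ℝ :=
  fderiv ℝ (fun z => B z v w) y u - fderiv ℝ (fun z => B z u w) y v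
    + fderiv ℝ (fun z => B z u v) y w

theorem flatExtDeriv_congr {B B' : V → V →L[ℝ] V →L[ℝ] ℝ} {y : V} (h : B =ᶠ[𝓝 y] B') (u v w : V) :
    flatExtDeriv B y u v w = flatExtDeriv B' y u v w := by
  have h' (a b : V) : fderiv ℝ (fun z => B z a b) y = fderiv ℝ (fun z => B' z a b) y :=
    Filter.EventuallyEq.fderiv_eq (h.mono fun z hz => by simp only [hz])
  simp only [flatExtDeriv, h']

theorem flatExtDeriv_eq {B : V → V →L[ℝ] V →L[ℝ] ℝ} {y : V} (hB : DifferentiableAt ℝ B y)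
    (u v w : V) : flatExtDeriv B y u v w =
      fderiv ℝ B y u v w - fderiv ℝ B y v u w + fderiv ℝ B y w u v := by
  have h (a b c : V) : fderiv ℝ (fun z => B z a b) y c = fderiv ℝ B y c a b := by
    rw [(((hB.hasFDerivAt.clm_apply (hasFDerivAt_const a y)).clm_apply
      (hasFDerivAt_const b y)).fderiv)]
    simp
  simp only [flatExtDeriv, h]

/-- The exterior derivative of alternating bilinear forms commutes with pull-back. -/
theorem flatExtDeriv_bilinComp {F : V → W} {B : W → W →L[ℝ] W →L[ℝ] ℝ} {y : V}
    (hF : ContDiffAt ℝ 2 F y) (hB : DifferentiableAt ℝ B (F y))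
    (hBa : ∀ a b, B (F y) a b = - B (F y) b a) (u v w : V) :
    flatExtDeriv (fun z => bilinComp (B (F z)) (fderiv ℝ F z)) y u v w =
      flatExtDeriv B (F y) (fderiv ℝ F y u) (fderiv ℝ F y v) (fderiv ℝ F y w) := by
  have hF1 : DifferentiableAt ℝ F y := hF.differentiableAt (by norm_num)
  have hF2 : DifferentiableAt ℝ (fderiv ℝ F) y :=
    (hF.fderiv_right (m := 1) (by norm_num)).differentiableAt (by norm_num)
  have hsymm (a b : V) : fderiv ℝ (fderiv ℝ F) y a b = fderiv ℝ (fderiv ℝ F) y b a :=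
    (hF.isSymmSndFDerivAt (by simp)).eq a b
  have h (a b c : V) : fderiv ℝ (fun z => bilinComp (B (F z)) (fderiv ℝ F z) a b) y c =
      fderiv ℝ B (F y) (fderiv ℝ F y c) (fderiv ℝ F y a) (fderiv ℝ F y b)
      + B (F y) (fderiv ℝ (fderiv ℝ F) y c a) (fderiv ℝ F y b)
      + B (F y) (fderiv ℝ F y a) (fderiv ℝ (fderiv ℝ F) y c b) := by
    simp only [bilinComp_apply]
    have hBF : HasFDerivAt (fun z => B (F z)) ((fderiv ℝ B (F y)).comp (fderiv ℝ F y)) y :=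
      HasFDerivAt.comp (g := B) y hB.hasFDerivAt hF1.hasFDerivAt
    have hA (a : V) := hF2.hasFDerivAt.clm_apply (hasFDerivAt_const a y)
    rw [((hBF.clm_apply (hA a)).clm_apply (hA b)).fderiv]
    simp
    ring
  rw [flatExtDeriv_eq hB]
  simp only [flatExtDeriv, h]
  -- The terms containing second derivatives of `F` cancel in pairs, by symmetry of the second
  -- derivative and antisymmetry of `B`.
  rw [hBa (fderiv ℝ (fderiv ℝ F) y w u), hBa (fderiv ℝ F y v), hsymm v u, hsymm w v, hsymm w u,
    hBa (fderiv ℝ F y v)]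
  ring

end Linear

/-! ### Fields of forms and differentials in charts -/

section Coordinates

variable {E : Type*} [NormedAddCommGroup E] [NormedSpace ℂ E]
  {M : Type*} [TopologicalSpace M] [ChartedSpace E M]
  {E' : Type*} [NormedAddCommGroup E'] [NormedSpace ℂ E']
  {N : Type*} [TopologicalSpace N] [ChartedSpace E' N]

/-- The value at `x` of a field of bilinear forms, as a bilinear form on the model space. -/
def formAt (T : BilinField E M) (x : M) : E →L[ℝ] E →L[ℝ] ℝ := T x

/-- The differential at `x` of a map, as a linear map between the model spaces. -/
def diffAt (E : Type*) [NormedAddCommGroup E] [NormedSpace ℂ E] {M : Type*} [TopologicalSpace M]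
    [ChartedSpace E M] (E' : Type*) [NormedAddCommGroup E'] [NormedSpace ℂ E']
    {N : Type*} [TopologicalSpace N] [ChartedSpace E' N] (f : M → N) (x : M) : E →L[ℝ] E' :=
  mfderiv 𝓘(ℝ, E) 𝓘(ℝ, E') f x

theorem formAt_pullback (f : M → N) (T : BilinField E' N) (x : M) :
    formAt (E := E) (pullback f T) x = bilinComp (formAt T (f x)) (diffAt E E' f x) := rfl

theorem diffAt_comp {E'' : Type*} [NormedAddCommGroup E''] [NormedSpace ℂ E'']
    {P : Type*} [TopologicalSpace P] [ChartedSpace E'' P] {g : N → P} {f : M → N} {x : M}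
    (hg : MDifferentiableAt 𝓘(ℝ, E') 𝓘(ℝ, E'') g (f x))
    (hf : MDifferentiableAt 𝓘(ℝ, E) 𝓘(ℝ, E') f x) :
    diffAt E E'' (g ∘ f) x = (diffAt E' E'' g (f x)).comp (diffAt E E' f x) :=
  mfderiv_comp x hg hf

theorem diffAt_congr {f f' : M → N} {x : M} (h : f =ᶠ[𝓝 x] f') :
    diffAt E E' f x = diffAt E E' f' x :=
  h.mfderiv_eq

theorem diffAt_id (x : M) : diffAt E E (id : M → M) x = ContinuousLinearMap.id ℝ E :=
  mfderiv_id

theorem diffAt_eq_fderiv (f : E → E') (x : E) : diffAt E E' f x = fderiv ℝ f x :=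
  mfderiv_eq_fderiv

/-- The expression of a field of bilinear forms in the chart at `x`. -/
def coordForm (T : BilinField E M) (x : M) (y : E) : E →L[ℝ] E →L[ℝ] ℝ :=
  formAt (pullback (chartAt E x).symm T) y

theorem extDerivForm_eq (T : BilinField E M) (x : M) (u v w : E) :
    extDerivForm T x u v w = flatExtDeriv (coordForm T x) (chartAt E x x) u v w := rfl

/-- A field of bilinear forms is smooth at `x` if its expression in the chart at `x` is smooth. -/
def SmoothFormAt (T : BilinField E M) (x : M) : Prop :=
  ContDiffAt ℝ ∞ (coordForm T x) (chartAt E x x)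

variable [IsManifold 𝓘(ℂ, E) ω M]

-- The trivialization of the tangent bundle at `x₀` is inverted by the differential of the inverse
-- chart, so bundle coordinates of `T` are exactly `coordForm T x₀` read through the chart.
open Bundle in
theorem contMDiffAt_iff_smoothFormAt (T : BilinField E M) (x₀ : M) :
    ContMDiffAt 𝓘(ℝ, E) (𝓘(ℝ, E).prod 𝓘(ℝ, E →L[ℝ] E →L[ℝ] ℝ)) ∞
      (fun b ↦ TotalSpace.mk' (E →L[ℝ] E →L[ℝ] ℝ)
        (E := fun x : M => TangentSpace 𝓘(ℝ, E) x →L[ℝ] TangentSpace 𝓘(ℝ, E) x →L[ℝ] ℝ) b (T b)) x₀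
      ↔ SmoothFormAt T x₀ := by
  refine (contMDiffAt_hom_bundle _).trans ?_
  refine (and_iff_right contMDiffAt_id).trans ?_
  have h1 (x : M) (hx : x ∈ (chartAt E x₀).source) :
      ContinuousLinearMap.inCoordinates E (TangentSpace 𝓘(ℝ, E)) (E →L[ℝ] ℝ)
        (fun x : M ↦ TangentSpace 𝓘(ℝ, E) x →L[ℝ] ℝ) x₀ x x₀ x (T x)
      = coordForm T x₀ (chartAt E x₀ x) := by
    have hA : ((trivializationAt E (TangentSpace 𝓘(ℝ, E)) x₀).symmL ℝ x : E →L[ℝ] E)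
        = diffAt E E (chartAt E x₀).symm (chartAt E x₀ x) := by
      refine (TangentBundle.symmL_trivializationAt (I := 𝓘(ℝ, E)) hx).trans ?_
      simp only [modelWithCornersSelf_coe, Set.range_id, mfderivWithin_univ, extChartAt_coe,
        extChartAt_coe_symm]
      rfl
    ext v w
    rw [inCoordinates_apply_eq₂ (by simpa using hx) (by simpa using hx) (by simp)]
    rw [coordForm, formAt_pullback, ← hA, (chartAt E x₀).left_inv hx]
    rw [← Bundle.Trivialization.symmL_apply (R := ℝ) _ (by simpa using hx),
      ← Bundle.Trivialization.symmL_apply (R := ℝ) _ (by simpa using hx)]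
    simp
    rfl
  have hsrc := (chartAt E x₀).open_source.mem_nhds (mem_chart_source E x₀)
  have h2 : ContMDiffAt 𝓘(ℝ, E) 𝓘(ℝ, E) ∞ (chartAt E x₀) x₀ :=
    contMDiffAt_of_mem_maximalAtlas (IsManifold.chart_mem_maximalAtlas x₀) (mem_chart_source E x₀)
  have h3 : ContMDiffAt 𝓘(ℝ, E) 𝓘(ℝ, E) ∞ (chartAt E x₀).symm (chartAt E x₀ x₀) :=
    (contMDiffOn_symm_of_mem_maximalAtlas (IsManifold.chart_mem_maximalAtlas x₀)).contMDiffAt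
      ((chartAt E x₀).open_target.mem_nhds (mem_chart_target E x₀))
  have h4 : (fun x => ContinuousLinearMap.inCoordinates E (TangentSpace 𝓘(ℝ, E)) (E →L[ℝ] ℝ)
        (fun x : M ↦ TangentSpace 𝓘(ℝ, E) x →L[ℝ] ℝ) x₀ x x₀ x (T x)) =ᶠ[𝓝 x₀]
        coordForm T x₀ ∘ chartAt E x₀ := Filter.eventually_of_mem hsrc h1
  refine h4.contMDiffAt_iff.trans ?_
  rw [SmoothFormAt, ← contMDiffAt_iff_contDiffAt]
  refine ⟨fun h => ?_, fun h => h.comp x₀ h2⟩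
  have h5 := ContMDiffAt.comp (g := coordForm T x₀ ∘ chartAt E x₀) (chartAt E x₀ x₀)
    (by rwa [(chartAt E x₀).left_inv (mem_chart_source E x₀)]) h3
  refine h5.congr_of_eventuallyEq ?_
  filter_upwards [(chartAt E x₀).open_target.mem_nhds (mem_chart_target E x₀)] with y hy
  simp [(chartAt E x₀).right_inv hy]

end Coordinates

/-! ### Naturality of smoothness, of `d` and of the fundamental form -/

section Naturality

variable {E : Type*} [NormedAddCommGroup E] [NormedSpace ℂ E]
  {M : Type*} [TopologicalSpace M] [ChartedSpace E M]
  {E' : Type*} [NormedAddCommGroup E'] [NormedSpace ℂ E']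
  {N : Type*} [TopologicalSpace N] [ChartedSpace E' N]

theorem _root_.ContMDiffWithinAt.real_of_complex {n : WithTop ℕ∞} {f : M → N} {s : Set M} {x : M}
    (h : ContMDiffWithinAt 𝓘(ℂ, E) 𝓘(ℂ, E') n f s x) :
    ContMDiffWithinAt 𝓘(ℝ, E) 𝓘(ℝ, E') n f s x := by
  rw [contMDiffWithinAt_iff] at h ⊢
  exact ⟨h.1, h.2.restrict_scalars ℝ⟩

theorem _root_.ContMDiffAt.real_of_complex {n : WithTop ℕ∞} {f : M → N} {x : M}
    (h : ContMDiffAt 𝓘(ℂ, E) 𝓘(ℂ, E') n f x) : ContMDiffAt 𝓘(ℝ, E) 𝓘(ℝ, E') n f x :=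
  ContMDiffWithinAt.real_of_complex h

theorem diffAt_eq_fderiv_chart {f : M → N} {x : M}
    (hf : MDifferentiableAt 𝓘(ℝ, E) 𝓘(ℝ, E') f x) :
    diffAt E E' f x =
      fderiv ℝ (chartAt E' (f x) ∘ f ∘ (chartAt E x).symm) (chartAt E x x) := by
  refine hf.mfderiv.trans ?_
  rw [modelWithCornersSelf_coe, Set.range_id, fderivWithin_univ]
  rfl

/-- The differential of a holomorphic map is complex linear. -/
theorem diffAt_smul {f : M → N} {x : M} (hf : MDifferentiableAt 𝓘(ℂ, E) 𝓘(ℂ, E') f x)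
    (c : ℂ) (v : E) : diffAt E E' f x (c • v) = c • diffAt E E' f x v := by
  have hd : DifferentiableAt ℂ (chartAt E' (f x) ∘ f ∘ (chartAt E x).symm) (chartAt E x x) := by
    have := hf.2
    simpa [DifferentiableWithinAtProp, differentiableWithinAt_univ] using this
  have hr : MDifferentiableAt 𝓘(ℝ, E) 𝓘(ℝ, E') f x := by
    refine ⟨hf.1, ?_⟩
    have := hd.restrictScalars ℝ
    simpa [DifferentiableWithinAtProp, differentiableWithinAt_univ] using this
  rw [diffAt_eq_fderiv_chart hr, hd.fderiv_restrictScalars ℝ]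
  exact (fderiv ℂ (chartAt E' (f x) ∘ f ∘ (chartAt E x).symm) (chartAt E x x)).map_smul c v

/-- The chain rule applied to `f ∘ φ⁻¹ = ψ⁻¹ ∘ F`, valid near the point. It reduces naturality on
manifolds to the computation in vector spaces. -/
theorem coordForm_pullback [IsManifold 𝓘(ℂ, E) ω M] [IsManifold 𝓘(ℂ, E') ω N]
    {f : M → N} {x : M}
    (hf : ContMDiffAt 𝓘(ℝ, E) 𝓘(ℝ, E') 1 f x) (T : BilinField E' N) :
    let F := chartAt E' (f x) ∘ f ∘ (chartAt E x).symm
    coordForm (E := E) (pullback f T) x =ᶠ[𝓝 (chartAt E x x)]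
      fun y => bilinComp (coordForm T (f x) (F y)) (fderiv ℝ F y) := by
  intro F
  set φ := chartAt E x with hφ
  set ψ := chartAt E' (f x) with hψ
  have hφx : φ.symm (φ x) = x := φ.left_inv (mem_chart_source E x)
  have hφc : ContinuousAt φ.symm (φ x) := φ.continuousAt_symm (mem_chart_target E x)
  have h1 : ∀ᶠ y in 𝓝 (φ x), ContMDiffAt 𝓘(ℝ, E) 𝓘(ℝ, E') 1 f (φ.symm y) := by
    have h : ∀ᶠ z in 𝓝 (φ.symm (φ x)), ContMDiffAt 𝓘(ℝ, E) 𝓘(ℝ, E') 1 f z := by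
      rw [hφx]
      exact (contMDiffAt_iff_contMDiffAt_nhds (by simp)).1 hf
    exact hφc.eventually h
  have h2 : ∀ᶠ y in 𝓝 (φ x), f (φ.symm y) ∈ ψ.source := by
    have h : ∀ᶠ z in 𝓝 (φ.symm (φ x)), f z ∈ ψ.source := by
      rw [hφx]
      exact hf.continuousAt.preimage_mem_nhds (ψ.open_source.mem_nhds (mem_chart_source E' (f x)))
    exact hφc.eventually h
  filter_upwards [h1, h2, φ.open_target.mem_nhds (mem_chart_target E x), h2.eventually_nhds]
    with y hy1 hy2 hy3 hy4
  have d1 : MDifferentiableAt 𝓘(ℝ, E) 𝓘(ℝ, E) φ.symm y :=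
    ((contMDiffOn_symm_of_mem_maximalAtlas (n := 1)
      (IsManifold.chart_mem_maximalAtlas x)).contMDiffAt
      (φ.open_target.mem_nhds hy3)).mdifferentiableAt one_ne_zero
  have d2 : MDifferentiableAt 𝓘(ℝ, E) 𝓘(ℝ, E') f (φ.symm y) := hy1.mdifferentiableAt one_ne_zero
  have d3 : MDifferentiableAt 𝓘(ℝ, E') 𝓘(ℝ, E') ψ (f (φ.symm y)) :=
    (contMDiffAt_of_mem_maximalAtlas (n := 1) (IsManifold.chart_mem_maximalAtlas _)
      hy2).mdifferentiableAt one_ne_zero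
  have d4 : MDifferentiableAt 𝓘(ℝ, E') 𝓘(ℝ, E') ψ.symm (F y) :=
    ((contMDiffOn_symm_of_mem_maximalAtlas (n := 1)
      (IsManifold.chart_mem_maximalAtlas (f x))).contMDiffAt
      (ψ.open_target.mem_nhds (ψ.map_source hy2))).mdifferentiableAt one_ne_zero
  have e1 : f ∘ φ.symm =ᶠ[𝓝 y] ψ.symm ∘ F := by
    filter_upwards [hy4] with z hz
    exact (ψ.left_inv hz).symm
  have e2 : (diffAt E E' f (φ.symm y)).comp (diffAt E E φ.symm y) =
      (diffAt E' E' ψ.symm (F y)).comp (fderiv ℝ F y) := by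
    rw [← diffAt_comp d2 d1, diffAt_congr e1, ← diffAt_eq_fderiv, diffAt_comp d4]
    exact d3.comp y (d2.comp y d1)
  have e3 : ψ.symm (F y) = f (φ.symm y) := ψ.left_inv hy2
  simp only [coordForm, formAt_pullback, bilinComp_bilinComp, ← hφ, ← hψ]
  rw [e2, e3]

theorem SmoothFormAt.pullback [IsManifold 𝓘(ℂ, E) ω M] [IsManifold 𝓘(ℂ, E') ω N]
    {f : M → N} {x : M}
    {T : BilinField E' N} (hT : SmoothFormAt T (f x))
    (hf : ContMDiffAt 𝓘(ℝ, E) 𝓘(ℝ, E') ∞ f x) :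
    SmoothFormAt (E := E) (pullback f T) x := by
  refine ContDiffAt.congr_of_eventuallyEq ?_ (coordForm_pullback (hf.of_le (by simp)) T)
  have hF : ContDiffAt ℝ ∞ (chartAt E' (f x) ∘ f ∘ (chartAt E x).symm) (chartAt E x x) := by
    simpa [contDiffWithinAt_univ] using (contMDiffAt_iff.1 hf).2
  refine ContDiffAt.bilinComp ?_ (hF.fderiv_right (by simp))
  refine ContDiffAt.comp (g := coordForm T (f x)) _ ?_ hF
  simpa [SmoothFormAt] using hT

/-- The exterior derivative of alternating fields commutes with pull-back. -/
theorem extDerivForm_pullback [IsManifold 𝓘(ℂ, E) ω M] [IsManifold 𝓘(ℂ, E') ω N]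
    {f : M → N} {x : M}
    {T : BilinField E' N} (hT : SmoothFormAt T (f x)) (hTa : ∀ y a b, T y a b = - T y b a)
    (hf : ContMDiffAt 𝓘(ℝ, E) 𝓘(ℝ, E') ∞ f x) (u v w : E) :
    extDerivForm (E := E) (LCK.pullback f T) x u v w =
      extDerivForm T (f x) (diffAt E E' f x u) (diffAt E E' f x v) (diffAt E E' f x w) := by
  have hF : ContDiffAt ℝ ∞ (chartAt E' (f x) ∘ f ∘ (chartAt E x).symm) (chartAt E x x) := by
    simpa [contDiffWithinAt_univ] using (contMDiffAt_iff.1 hf).2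
  have hFx : (chartAt E' (f x) ∘ f ∘ (chartAt E x).symm) (chartAt E x x) = chartAt E' (f x) (f x) :=
    by simp
  rw [extDerivForm_eq, flatExtDeriv_congr (coordForm_pullback (hf.of_le (by simp)) T),
    flatExtDeriv_bilinComp (hF.of_le (by norm_cast)), hFx,
    diffAt_eq_fderiv_chart (hf.mdifferentiableAt (by simp)), extDerivForm_eq]
  · rw [hFx]; exact hT.differentiableAt (by simp)
  · exact fun a b => hTa _ _ _

theorem extDerivForm_congr {T T' : BilinField E M} {x : M} (h : ∀ᶠ y in 𝓝 x, T y = T' y)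
    (u v w : E) : extDerivForm T x u v w = extDerivForm T' x u v w := by
  rw [extDerivForm_eq, extDerivForm_eq]
  refine flatExtDeriv_congr ?_ u v w
  have hc : ContinuousAt (chartAt E x).symm (chartAt E x x) :=
    (chartAt E x).continuousAt_symm (mem_chart_target E x)
  rw [← (chartAt E x).left_inv (mem_chart_source E x)] at h
  filter_upwards [hc.eventually h] with y hy
  simp only [coordForm, formAt_pullback]
  rw [formAt, formAt, hy]

theorem extDerivForm_fundamentalForm_congr {T T' : BilinField E M} {x : M}
    (h : ∀ᶠ y in 𝓝 x, T y = T' y) (u v w : E) :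
    extDerivForm (fundamentalForm T) x u v w = extDerivForm (fundamentalForm T') x u v w :=
  extDerivForm_congr (h.mono fun y hy => by rw [fundamentalForm, fundamentalForm, hy]) u v w

/-- The differential of a holomorphic map commutes with `J`. -/
theorem fundamentalForm_pullback {f : M → N} {x : M}
    (hf : MDifferentiableAt 𝓘(ℂ, E) 𝓘(ℂ, E') f x) (T : BilinField E' N) :
    fundamentalForm (E := E) (pullback f T) x = pullback (E := E) f (fundamentalForm T) x := by
  have h (v w : E) : formAt (E := E) (fundamentalForm (E := E) (pullback f T)) x v w =
      formAt (E := E) (pullback f (fundamentalForm T)) x v w := by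
    change formAt T (f x) (diffAt E E' f x (Complex.I • v)) _ =
      formAt T (f x) (Complex.I • diffAt E E' f x v) _
    rw [diffAt_smul hf]
  ext v w
  exact h v w

/-- Inverse charts are holomorphic, so `J` has constant coefficients in a chart. -/
theorem SmoothFormAt.fundamentalForm [IsManifold 𝓘(ℂ, E) ω M] {T : BilinField E M} {x : M}
    (hT : SmoothFormAt T x) : SmoothFormAt (fundamentalForm T) x := by
  have h : ContDiffAt ℝ ∞ (fun y => (coordForm T x y).comp
      (Complex.I • ContinuousLinearMap.id ℝ E : E →L[ℝ] E)) (chartAt E x x) :=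
    ContDiffAt.clm_comp hT contDiffAt_const
  refine h.congr_of_eventuallyEq ?_
  filter_upwards [(chartAt E x).open_target.mem_nhds (mem_chart_target E x)] with y hy
  have d1 : MDifferentiableAt 𝓘(ℂ, E) 𝓘(ℂ, E) (chartAt E x).symm y :=
    ((contMDiffOn_symm_of_mem_maximalAtlas (n := ω)
      (IsManifold.chart_mem_maximalAtlas x)).contMDiffAt
      ((chartAt E x).open_target.mem_nhds hy)).mdifferentiableAt (by simp)
  have := fundamentalForm_pullback d1 T
  rw [coordForm, formAt, ← this]
  rfl

end Naturality

/-! ### Positive forms, the Leibniz rule and the wedge with the fundamental form -/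

section LinearAlgebra

variable {V : Type*} [NormedAddCommGroup V] [NormedSpace ℝ V]

/-- By compactness of the unit sphere and homogeneity, `B v v` dominates a positive multiple of `‖v‖
^ 2`. Riemannian metrics carry this boundedness as a field. -/
theorem isVonNBounded_of_pos [FiniteDimensional ℝ V] (B : V →L[ℝ] V →L[ℝ] ℝ)
    (hB : ∀ v, v ≠ 0 → 0 < B v v) : Bornology.IsVonNBounded ℝ {v : V | B v v < 1} := by
  rw [NormedSpace.isVonNBounded_iff]
  rcases subsingleton_or_nontrivial V with hV | hV
  · exact (Set.toFinite _).isBounded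
  have : ProperSpace V := FiniteDimensional.proper ℝ V
  have hc : Continuous fun v => B v v := by fun_prop
  obtain ⟨v₀, hv₀, hmin⟩ := (isCompact_sphere (0 : V) 1).exists_isMinOn
    (NormedSpace.sphere_nonempty.2 zero_le_one) hc.continuousOn
  have hm : 0 < B v₀ v₀ := hB v₀ (by
    rintro rfl
    simp at hv₀)
  have hle (v : V) : B v₀ v₀ * ‖v‖ ^ 2 ≤ B v v := by
    rcases eq_or_ne v 0 with rfl | hv
    · simp
    have h1 : B v₀ v₀ ≤ B (‖v‖⁻¹ • v) (‖v‖⁻¹ • v) := hmin (by simp [norm_smul, hv])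
    have hn : 0 < ‖v‖ := norm_pos_iff.2 hv
    simp only [map_smul, smul_apply, smul_eq_mul] at h1
    calc B v₀ v₀ * ‖v‖ ^ 2 ≤ (‖v‖⁻¹ * (‖v‖⁻¹ * B v v)) * ‖v‖ ^ 2 := by gcongr
      _ = B v v := by field_simp
  -- The radius is crude: `t ^ 2 < a` gives `2 * t ≤ 1 + t ^ 2 < 1 + a`.
  refine (Metric.isBounded_closedBall (x := (0 : V)) (r := 1 + (B v₀ v₀)⁻¹)).subset fun v hv => ?_
  rw [mem_closedBall_zero_iff]
  have h2 : B v₀ v₀ * ‖v‖ ^ 2 < 1 := (hle v).trans_lt hv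
  have h3 : ‖v‖ ^ 2 < (B v₀ v₀)⁻¹ := by rwa [inv_eq_one_div, lt_div_iff₀' hm]
  nlinarith [sq_nonneg (‖v‖ - 1), norm_nonneg v]

instance isBoundedSMul_bilin : IsBoundedSMul ℝ (V →L[ℝ] V →L[ℝ] ℝ) := by
  exact NormedSpace.toIsBoundedSMul (𝕜 := ℝ) (E := V →L[ℝ] V →L[ℝ] ℝ)

/-- Leibniz rule `d(cB) = c dB + dc ∧ B`. -/
theorem flatExtDeriv_smul {c : V → ℝ} {B : V → V →L[ℝ] V →L[ℝ] ℝ} {y : V}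
    (hc : DifferentiableAt ℝ c y) (hB : DifferentiableAt ℝ B y) (u v w : V) :
    flatExtDeriv (fun z => c z • B z) y u v w = c y * flatExtDeriv B y u v w +
      (fderiv ℝ c y u * B y v w - fderiv ℝ c y v * B y u w + fderiv ℝ c y w * B y u v) := by
  have h : HasFDerivAt (fun z => c z • B z) _ y :=
    HasFDerivAt.smul (f := B) hc.hasFDerivAt hB.hasFDerivAt
  rw [flatExtDeriv_eq hB, flatExtDeriv_eq h.differentiableAt, h.fderiv]
  simp
  ring

/-- The wedge product with the fundamental form of a Hermitian scalar product is injective on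
linear forms, in complex dimension at least two. -/
theorem eq_zero_of_wedge_eq_zero {E : Type*} [NormedAddCommGroup E] [NormedSpace ℂ E]
    [FiniteDimensional ℂ E] (hE : 2 ≤ Module.finrank ℂ E) (G : E →L[ℝ] E →L[ℝ] ℝ)
    (hpos : ∀ v, v ≠ 0 → 0 < G v v)
    (hJ : ∀ v w, G (Complex.I • v) (Complex.I • w) = G v w) (θ : E →L[ℝ] ℝ)
    (h : ∀ u v w, θ u * G (Complex.I • v) w - θ v * G (Complex.I • u) w +
      θ w * G (Complex.I • u) v = 0) : θ = 0 := by
  ext u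
  -- Real dimension at least 4 leaves a nonzero `v` orthogonal to `u` and `I • u`. Testing the
  -- hypothesis on `u, v, I • v` then leaves only `θ u * G v v = 0`.
  let L : E →ₗ[ℝ] ℝ × ℝ := (G u : E →ₗ[ℝ] ℝ).prod (G (Complex.I • u) : E →ₗ[ℝ] ℝ)
  have : FiniteDimensional ℝ E := FiniteDimensional.complexToReal E
  have hL : LinearMap.ker L ≠ ⊥ := by
    refine LinearMap.ker_ne_bot_of_finrank_lt ?_
    rw [finrank_real_of_complex]
    simp
    omega
  obtain ⟨v, hv, hv0⟩ := (Submodule.ne_bot_iff _).1 hL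
  have hv' : G u v = 0 ∧ G (Complex.I • u) v = 0 := by
    simpa [L] using hv
  have h1 := h u v (Complex.I • v)
  rw [hJ, hJ, hv'.1, hv'.2] at h1
  have := (hpos v hv0).ne'
  simpa [this] using h1

end LinearAlgebra

/-! ### Pointwise algebra of forms and local biholomorphisms -/

section Forms

variable {E : Type*} [NormedAddCommGroup E] [NormedSpace ℂ E]
  {M : Type*} [TopologicalSpace M] [ChartedSpace E M]
  {E' : Type*} [NormedAddCommGroup E'] [NormedSpace ℂ E']
  {N : Type*} [TopologicalSpace N] [ChartedSpace E' N]

theorem formAt_fundamentalForm (T : BilinField E M) (x : M) (v w : E) :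
    formAt (fundamentalForm T) x v w = formAt T x (Complex.I • v) w := rfl

/-- Apply `I` to both arguments and use `I * I = -1` with the symmetry of `T`. -/
theorem fundamentalForm_antisymm (T : BilinField E M)
    (hsymm : ∀ x v w, formAt T x v w = formAt T x w v)
    (hI : ∀ x v w, formAt T x (Complex.I • v) (Complex.I • w) = formAt T x v w) (x : M) (v w : E) :
    formAt (fundamentalForm T) x v w = - formAt (fundamentalForm T) x w v := by
  rw [formAt_fundamentalForm, formAt_fundamentalForm, ← hI, smul_smul, Complex.I_mul_I, hsymm]
  simp

theorem SmoothFormAt.smul {c : M → ℝ} {T : BilinField E M} {x : M}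
    (hc : ContMDiffAt 𝓘(ℝ, E) 𝓘(ℝ, ℝ) ∞ c x) (hT : SmoothFormAt T x) :
    SmoothFormAt (fun y => c y • T y) x := by
  have h : ContDiffAt ℝ ∞ (c ∘ (chartAt E x).symm) (chartAt E x x) := by
    simpa [contDiffWithinAt_univ, chartAt_self_eq] using (contMDiffAt_iff.1 hc).2
  exact ContDiffAt.smul (f := c ∘ (chartAt E x).symm) (g := coordForm T x) h hT

theorem ConformalTo.formAt {T T' : BilinField E M} (h : ConformalTo T T') (x : M) :
    ∃ c : ℝ, 0 < c ∧ formAt T' x = c • formAt T x := by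
  obtain ⟨α, -, hα⟩ := h
  exact ⟨_, Real.exp_pos (α x), hα x⟩

theorem isLocalDiffeomorphAt_of_openPartialHomeomorph {n : WithTop ℕ∞}
    (e : OpenPartialHomeomorph M N) (he : ContMDiffOn 𝓘(ℂ, E) 𝓘(ℂ, E') n e e.source)
    (he' : ContMDiffOn 𝓘(ℂ, E') 𝓘(ℂ, E) n e.symm e.target) {f : M → N} (hf : Set.EqOn f e e.source)
    {x : M} (hx : x ∈ e.source) : IsLocalDiffeomorphAt 𝓘(ℂ, E) 𝓘(ℂ, E') n f x :=
  ⟨⟨e.toPartialEquiv, e.open_source, e.open_target, he, he'⟩, hx, hf⟩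

theorem _root_.IsLocalDiffeomorphAt.diffAt_bijective {f : M → N} {x : M}
    (hf : IsLocalDiffeomorphAt 𝓘(ℂ, E) 𝓘(ℂ, E') ω f x) : Function.Bijective (diffAt E E' f x) := by
  have d1 : MDifferentiableAt 𝓘(ℝ, E) 𝓘(ℝ, E') f x :=
    hf.contMDiffAt.real_of_complex.mdifferentiableAt (by simp)
  have d2 : MDifferentiableAt 𝓘(ℝ, E') 𝓘(ℝ, E) hf.localInverse (f x) :=
    hf.localInverse_contMDiffAt.real_of_complex.mdifferentiableAt (by simp)
  have hx : hf.localInverse (f x) = x := hf.localInverse_left_inv hf.localInverse_mem_target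
  have e1 := diffAt_comp d2 d1
  have e2 := diffAt_comp (g := f) (f := hf.localInverse) (x := f x) (by rwa [hx]) d2
  rw [diffAt_congr hf.localInverse_eventuallyEq_left, diffAt_id] at e1
  rw [diffAt_congr hf.localInverse_eventuallyEq_right, diffAt_id, hx] at e2
  constructor
  · exact Function.LeftInverse.injective fun v => (DFunLike.congr_fun e1 v).symm
  · exact Function.RightInverse.surjective fun v => (DFunLike.congr_fun e2 v).symm

theorem formAt_pullback_I [IsManifold 𝓘(ℂ, E') ω N] {f : M → N} {x : M}
    (hf : MDifferentiableAt 𝓘(ℂ, E) 𝓘(ℂ, E') f x)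
    (g : HermitianMetric E' N) (v w : E) :
    formAt (E := E) (pullback f g.form) x (Complex.I • v) (Complex.I • w) =
      formAt (E := E) (pullback f g.form) x v w := by
  simp only [formAt_pullback, bilinComp_apply, diffAt_smul hf]
  exact g.hermitian _ _ _

end Forms

/-! ### Constructing Hermitian metrics and comparing them -/

section Metrics

variable {E : Type*} [NormedAddCommGroup E] [NormedSpace ℂ E]
  {M : Type*} [TopologicalSpace M] [ChartedSpace E M] [IsManifold 𝓘(ℂ, E) ω M]

theorem HermitianMetric.smoothFormAt (g : HermitianMetric E M) (x : M) :
    SmoothFormAt g.form x :=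
  (contMDiffAt_iff_smoothFormAt g.form x).1 g.contMDiff.contMDiffAt

theorem HermitianMetric.formAt_symm (g : HermitianMetric E M) (x : M) (v w : E) :
    formAt g.form x v w = formAt g.form x w v := g.symm x v w

theorem HermitianMetric.formAt_pos (g : HermitianMetric E M) (x : M) (v : E) (hv : v ≠ 0) :
    0 < formAt g.form x v v := g.pos x v hv

theorem HermitianMetric.formAt_I (g : HermitianMetric E M) (x : M) (v w : E) :
    formAt g.form x (Complex.I • v) (Complex.I • w) = formAt g.form x v w := g.hermitian x v w

/-- The Hermitian metric with a given field of scalar products. -/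
def HermitianMetric.ofForm [FiniteDimensional ℂ E] (T : BilinField E M)
    (hsymm : ∀ x v w, formAt T x v w = formAt T x w v)
    (hpos : ∀ x v, v ≠ 0 → 0 < formAt T x v v)
    (hI : ∀ x v w, formAt T x (Complex.I • v) (Complex.I • w) = formAt T x v w)
    (hT : ∀ x, SmoothFormAt T x) : HermitianMetric E M where
  inner := T
  symm := hsymm
  pos := hpos
  isVonNBounded x :=
    haveI : FiniteDimensional ℝ E := FiniteDimensional.complexToReal E
    isVonNBounded_of_pos (formAt T x) (hpos x)
  contMDiff x := (contMDiffAt_iff_smoothFormAt T x).2 (hT x)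
  hermitian := hI

/-- The Hermitian metric `e^α g`. -/
def HermitianMetric.expSmul [FiniteDimensional ℂ E] (g : HermitianMetric E M) (α : M → ℝ)
    (hα : ContMDiff 𝓘(ℝ, E) 𝓘(ℝ, ℝ) ∞ α) : HermitianMetric E M :=
  ofForm (fun x => Real.exp (α x) • g.form x)
    (fun x v w => congrArg (Real.exp (α x) * ·) (g.formAt_symm x v w))
    (fun x v hv => mul_pos (Real.exp_pos _) (g.formAt_pos x v hv))
    (fun x v w => congrArg (Real.exp (α x) * ·) (g.formAt_I x v w))
    (fun x => SmoothFormAt.smul (Real.contDiff_exp.contMDiff.comp hα).contMDiffAt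
      (g.smoothFormAt x))

theorem isLocalDiffeomorphAt_chartAt_symm (x : M) {y : E} (hy : y ∈ (chartAt E x).target) :
    IsLocalDiffeomorphAt 𝓘(ℂ, E) 𝓘(ℂ, E) ω (chartAt E x).symm y :=
  isLocalDiffeomorphAt_of_openPartialHomeomorph (chartAt E x).symm
    (contMDiffOn_symm_of_mem_maximalAtlas (IsManifold.chart_mem_maximalAtlas x))
    (contMDiffOn_of_mem_maximalAtlas (IsManifold.chart_mem_maximalAtlas x)) (fun _ _ => rfl) hy

variable {E' : Type*} [NormedAddCommGroup E'] [NormedSpace ℂ E']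
  {N : Type*} [TopologicalSpace N] [ChartedSpace E' N] [IsManifold 𝓘(ℂ, E') ω N]

/-- The pull-back of a Hermitian metric by a local biholomorphism. -/
def HermitianMetric.pullback [FiniteDimensional ℂ E] (g : HermitianMetric E' N) (f : M → N)
    (hf : IsLocalDiffeomorph 𝓘(ℂ, E) 𝓘(ℂ, E') ω f) : HermitianMetric E M :=
  ofForm (LCK.pullback f g.form)
    (fun x v w => by simp only [formAt_pullback, bilinComp_apply, g.formAt_symm (f x)])
    (fun x v hv => g.formAt_pos _ _ ((map_ne_zero_iff _ (hf x).diffAt_bijective.1).2 hv))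
    (fun x v w => formAt_pullback_I (hf.contMDiff.mdifferentiable (by simp) x) g v w)
    (fun x => (g.smoothFormAt (f x)).pullback
      ((hf.contMDiff x).real_of_complex.of_le (by simp)))

/-- Hermitian metrics that are proportional at each point are conformal. -/
theorem conformalTo_of_formAt [Nontrivial E] (g k : HermitianMetric E M)
    (h : ∀ x, ∃ c : ℝ, formAt k.form x = c • formAt g.form x) : ConformalTo g.form k.form := by
  choose c hc using h
  obtain ⟨v, hv⟩ := exists_ne (0 : E)
  have hcpos (x : M) : 0 < c x := by
    have h1 := k.formAt_pos x v hv
    rw [hc] at h1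
    exact pos_of_mul_pos_left h1 (g.formAt_pos x v hv).le
  have hsmooth : ContMDiff 𝓘(ℝ, E) 𝓘(ℝ, ℝ) ∞ c := by
    intro x
    set φ := chartAt E x with hφ
    -- In a chart, `c` is the quotient of the values of the two metrics on the constant vector `v`,
    -- and the denominator is nonzero by positivity.
    have hg : ContDiffAt ℝ ∞ (fun y => coordForm g.form x y v v) (φ x) :=
      ((g.smoothFormAt x).clm_apply contDiffAt_const).clm_apply contDiffAt_const
    have hk : ContDiffAt ℝ ∞ (fun y => coordForm k.form x y v v) (φ x) :=
      ((k.smoothFormAt x).clm_apply contDiffAt_const).clm_apply contDiffAt_const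
    have hne : coordForm g.form x (φ x) v v ≠ 0 :=
      (g.formAt_pos _ _ ((map_ne_zero_iff _ (isLocalDiffeomorphAt_chartAt_symm x
        (mem_chart_target E x)).diffAt_bijective.1).2 hv)).ne'
    have hq := hk.div hg hne
    have hφs : ContMDiffAt 𝓘(ℝ, E) 𝓘(ℝ, E) ∞ φ x :=
      contMDiffAt_of_mem_maximalAtlas (IsManifold.chart_mem_maximalAtlas x) (mem_chart_source E x)
    refine (hq.contMDiffAt.comp x hφs).congr_of_eventuallyEq ?_
    filter_upwards [φ.open_source.mem_nhds (mem_chart_source E x),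
      hφs.continuousAt.eventually (hg.continuousAt.eventually_ne hne)] with z hz hz'
    simp only [Function.comp_apply, Pi.div_apply]
    rw [eq_div_iff hz']
    simp only [coordForm, formAt_pullback, bilinComp_apply, hc]
    rw [← hφ, φ.left_inv hz]
    rfl
  refine ⟨fun x => Real.log (c x), fun x => ?_, fun x => ?_⟩
  · exact ((Real.contDiffAt_log.2 (hcpos x).ne').contMDiffAt).comp x (hsmooth x)
  · rw [Real.exp_log (hcpos x)]
    exact hc x

end Metrics

/-! ### Rigidity of Kähler metrics in a conformal class -/

section Kahler

variable {E : Type*} [NormedAddCommGroup E] [NormedSpace ℂ E]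
  {M : Type*} [TopologicalSpace M] [ChartedSpace E M] [IsManifold 𝓘(ℂ, E) ω M]

/-- A smooth function whose differential vanishes is constant on a connected manifold. -/
theorem eq_of_fderiv_chart_eq_zero [PreconnectedSpace M] {h : M → ℝ}
    (hh : ContMDiff 𝓘(ℝ, E) 𝓘(ℝ, ℝ) ∞ h)
    (h0 : ∀ x, fderiv ℝ (h ∘ (chartAt E x).symm) (chartAt E x x) = 0) (x y : M) : h x = h y := by
  have hm (x : M) : mfderiv 𝓘(ℝ, E) 𝓘(ℝ, ℝ) h x = 0 := by
    refine ((hh x).mdifferentiableAt (by simp)).mfderiv.trans ?_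
    rw [modelWithCornersSelf_coe, Set.range_id, fderivWithin_univ]
    exact h0 x
  have hloc : IsLocallyConstant h := by
    rw [IsLocallyConstant.iff_eventually_eq]
    intro x
    set φ := chartAt E x with hφ
    obtain ⟨r, hr, hball⟩ := Metric.isOpen_iff.1 φ.open_target (φ x) (mem_chart_target E x)
    have hs (y : E) (hy : y ∈ φ.target) : MDifferentiableAt 𝓘(ℝ, E) 𝓘(ℝ, E) φ.symm y :=
      ((contMDiffOn_symm_of_mem_maximalAtlas (n := 1)
        (IsManifold.chart_mem_maximalAtlas x)).contMDiffAt
        (φ.open_target.mem_nhds hy)).mdifferentiableAt one_ne_zero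
    have hd (y : E) (hy : y ∈ φ.target) : HasFDerivAt (h ∘ φ.symm) (0 : E →L[ℝ] ℝ) y := by
      have h1 := HasMFDerivAt.comp y ((hh (φ.symm y)).mdifferentiableAt (by simp)).hasMFDerivAt
        (hs y hy).hasMFDerivAt
      rw [hm, ContinuousLinearMap.zero_comp] at h1
      exact h1.hasFDerivAt
    have hc : ContinuousAt φ x := φ.continuousAt (mem_chart_source E x)
    filter_upwards [φ.open_source.mem_nhds (mem_chart_source E x),
      hc.preimage_mem_nhds (Metric.ball_mem_nhds _ hr)] with z hz hz'
    -- A ball inside the chart target is convex, so vanishing of the differential there makes `h`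
    -- constant near `x`.
    have h2 := (convex_ball (φ x) r).is_const_of_fderivWithin_eq_zero (𝕜 := ℝ) (f := h ∘ φ.symm)
      (fun y hy => (hd y (hball hy)).differentiableAt.differentiableWithinAt)
      (fun y hy => by
        rw [fderivWithin_of_isOpen Metric.isOpen_ball hy, (hd y (hball hy)).fderiv])
      hz' (Metric.mem_ball_self hr)
    simpa [φ.left_inv hz, φ.left_inv (mem_chart_source E x)] using h2
  exact hloc.apply_eq_of_preconnectedSpace x y

theorem coordForm_self (T : BilinField E M) (x : M) : coordForm T x (chartAt E x x) = formAt T x := by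
  have h : diffAt E E (chartAt E x).symm (chartAt E x x) = ContinuousLinearMap.id ℝ E := by
    have := mfderivWithin_range_extChartAt_symm (I := 𝓘(ℝ, E)) (x := x)
    simp only [modelWithCornersSelf_coe, Set.range_id, mfderivWithin_univ, extChartAt_coe,
        extChartAt_coe_symm] at this
    exact this
  rw [coordForm, formAt_pullback, h, (chartAt E x).left_inv (mem_chart_source E x)]
  rfl

/-- Conformal Kähler metrics on a connected manifold of complex dimension at least two are
homothetic. -/
theorem exp_eq_of_isKahler [FiniteDimensional ℂ E] (hE : 2 ≤ Module.finrank ℂ E)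
    [PreconnectedSpace M] {g k : HermitianMetric E M} (hg : g.IsKahler) (hk : k.IsKahler)
    {α : M → ℝ} (hα : ContMDiff 𝓘(ℝ, E) 𝓘(ℝ, ℝ) ∞ α)
    (h : ∀ x, k.form x = Real.exp (α x) • g.form x) (x y : M) :
    Real.exp (α x) = Real.exp (α y) := by
  have hexp : ContMDiff 𝓘(ℝ, E) 𝓘(ℝ, ℝ) ∞ (fun x => Real.exp (α x)) :=
    Real.contDiff_exp.contMDiff.comp hα
  refine eq_of_fderiv_chart_eq_zero hexp (fun x => ?_) x y
  have hc : DifferentiableAt ℝ ((fun x => Real.exp (α x)) ∘ (chartAt E x).symm)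
      (chartAt E x x) := by
    have := (contMDiffAt_iff.1 (hexp x)).2
    simp only [modelWithCornersSelf_coe, Set.range_id, contDiffWithinAt_univ] at this
    exact this.differentiableAt (by simp)
  have hB : DifferentiableAt ℝ (coordForm (fundamentalForm g.form) x) (chartAt E x x) :=
    (g.smoothFormAt x).fundamentalForm.differentiableAt (by simp)
  refine eq_zero_of_wedge_eq_zero hE (formAt g.form x) (g.formAt_pos x) (g.formAt_I x) _
    fun u v w => ?_
  -- Both fundamental forms are closed, so the Leibniz rule leaves only `d(e^α) ∧ Ω = 0`.
  have h1 := flatExtDeriv_smul hc hB u v w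
  rw [← extDerivForm_eq, hg x u v w, coordForm_self] at h1
  have h2 : flatExtDeriv (fun z => ((fun x => Real.exp (α x)) ∘ (chartAt E x).symm) z •
      coordForm (fundamentalForm g.form) x z) (chartAt E x x) u v w =
      extDerivForm (fundamentalForm k.form) x u v w := by
    have : k.form = fun x => Real.exp (α x) • g.form x := funext h
    rw [this]
    rfl
  rw [h2, hk x u v w] at h1
  simpa [formAt_fundamentalForm] using h1.symm

/-- Closedness of the fundamental form of `T` at `f x` is closedness at `x` of that of `f^* T`. -/
theorem extDerivForm_fundamentalForm_pullback_eq_zero {N : Type*} [TopologicalSpace N]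
    [ChartedSpace E N] [IsManifold 𝓘(ℂ, E) ω N] {f : M → N} {x : M}
    (hf : ∀ y, IsLocalDiffeomorphAt 𝓘(ℂ, E) 𝓘(ℂ, E) ω f y) {T : BilinField E N}
    (hT : SmoothFormAt T (f x))
    (hsymm : ∀ x v w, formAt T x v w = formAt T x w v)
    (hI : ∀ x v w, formAt T x (Complex.I • v) (Complex.I • w) = formAt T x v w) :
    (∀ u v w, extDerivForm (fundamentalForm (pullback (E := E) f T)) x u v w = 0) ↔
      ∀ u v w, extDerivForm (fundamentalForm T) (f x) u v w = 0 := by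
  have h (u v w : E) : extDerivForm (fundamentalForm (pullback (E := E) f T)) x u v w =
      extDerivForm (fundamentalForm T) (f x) (diffAt E E f x u) (diffAt E E f x v)
        (diffAt E E f x w) := by
    rw [← extDerivForm_pullback hT.fundamentalForm (fundamentalForm_antisymm T hsymm hI)
      ((hf x).contMDiffAt.real_of_complex.of_le (by simp))]
    exact extDerivForm_congr (Filter.Eventually.of_forall fun y =>
      fundamentalForm_pullback ((hf y).contMDiffAt.mdifferentiableAt (by simp)) T) u v w
  refine ⟨fun h0 u v w => ?_, fun h0 u v w => by rw [h, h0]⟩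
  obtain ⟨u, rfl⟩ := (hf x).diffAt_bijective.2 u
  obtain ⟨v, rfl⟩ := (hf x).diffAt_bijective.2 v
  obtain ⟨w, rfl⟩ := (hf x).diffAt_bijective.2 w
  rw [← h, h0]

end Kahler

/-! ### The projection as a local biholomorphism -/

section Quotient

open MulAction

variable {E : Type*} [NormedAddCommGroup E] [NormedSpace ℂ E]
  {M : Type*} [TopologicalSpace M] [ChartedSpace E M]

theorem proj_surjective (Γ : Subgroup (Biholomorphism E M)) : Function.Surjective (proj Γ) :=
  Quotient.mk_surjective

theorem proj_apply (Γ : Subgroup (Biholomorphism E M)) {γ : Biholomorphism E M} (hγ : γ ∈ Γ)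
    (x : M) : proj Γ (γ x) = proj Γ x :=
  Quotient.sound ⟨⟨γ, hγ⟩, rfl⟩

theorem exists_apply_eq (Γ : Subgroup (Biholomorphism E M)) {x y : M}
    (h : proj Γ x = proj Γ y) : ∃ γ ∈ Γ, γ x = y := by
  obtain ⟨γ, hγ⟩ := Quotient.exact h.symm
  exact ⟨γ.1, γ.2, hγ⟩

variable [FiniteDimensional ℂ E] [T2Space M] (Γ : Subgroup (Biholomorphism E M))
  [IsCancelSMul Γ M] [ProperlyDiscontinuousSMul Γ M]

variable [IsManifold 𝓘(ℂ, E) ω M]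

/-- A chart of the quotient is a local inverse of the projection followed by a chart of `M`; near
the lift of `q` that it selects, the projection is thus a chart followed by an inverse chart. -/
theorem isLocalDiffeomorph_proj : IsLocalDiffeomorph 𝓘(ℂ, E) 𝓘(ℂ, E) ω (proj Γ) := by
  intro x
  set q := proj Γ x with hq
  obtain ⟨a, ha⟩ := exists_chart_eq Γ (chart_mem_atlas E q)
  have hp := isLocalHomeomorph_proj Γ
  have hqs := mem_chart_source E q
  set σ := hp.localInverseAt a with hσ
  have hs : q ∈ σ.source ∧ σ q ∈ (chartAt E a).source := by
    simpa [ha] using hqs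
  let e : OpenPartialHomeomorph M (orbitRel.Quotient Γ M) := (chartAt E a).trans (chartAt E q).symm
  have heq : Set.EqOn (proj Γ) e e.source := by
    intro y hy
    have hy' : y ∈ (chartAt E a).source := by
      simp only [e, OpenPartialHomeomorph.trans_source, Set.mem_inter_iff] at hy
      exact hy.1
    simp only [e, ha, OpenPartialHomeomorph.coe_trans, OpenPartialHomeomorph.coe_trans_symm,
      Function.comp_apply, (chartAt E a).left_inv hy', hσ, hp.localInverseAt_symm]
  have hsmooth : ContMDiffOn 𝓘(ℂ, E) 𝓘(ℂ, E) ω e e.source := by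
    refine ContMDiffOn.comp (t := (chartAt E q).target) (contMDiffOn_symm_of_mem_maximalAtlas
      (IsManifold.chart_mem_maximalAtlas q)) ((contMDiffOn_of_mem_maximalAtlas
      (IsManifold.chart_mem_maximalAtlas a)).mono fun y hy => ?_) fun y hy => ?_
    · exact hy.1
    · exact hy.2
  have hsmooth' : ContMDiffOn 𝓘(ℂ, E) 𝓘(ℂ, E) ω e.symm e.target := by
    refine ContMDiffOn.comp (t := (chartAt E a).target) (contMDiffOn_symm_of_mem_maximalAtlas
      (IsManifold.chart_mem_maximalAtlas a)) ((contMDiffOn_of_mem_maximalAtlas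
      (IsManifold.chart_mem_maximalAtlas q)).mono fun y hy => ?_) fun y hy => ?_
    · exact hy.1
    · exact hy.2
  have hσq : proj Γ (σ q) = q := hp.apply_localInverseAt_of_mem hs.1
  have hmem : σ q ∈ e.source := by
    refine ⟨hs.2, ?_⟩
    simp only [ha, OpenPartialHomeomorph.symm_source, OpenPartialHomeomorph.trans_target,
      Set.mem_preimage, Set.mem_inter_iff]
    refine ⟨(chartAt E a).map_source hs.2, ?_⟩
    rw [OpenPartialHomeomorph.symm_symm, (chartAt E a).left_inv hs.2]
    exact σ.map_source hs.1
  have hloc := isLocalDiffeomorphAt_of_openPartialHomeomorph e hsmooth hsmooth' heq hmem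
  -- The selected lift `σ q` may differ from `x`; an element of `Γ` carries `x` to it without
  -- changing the projection.
  obtain ⟨γ, hγ, hγx⟩ := exists_apply_eq Γ (x := x) (y := σ q) (by rw [hσq])
  have hγloc : IsLocalDiffeomorphAt 𝓘(ℂ, E) 𝓘(ℂ, E) ω γ x := γ.isLocalDiffeomorph x
  rw [← hγx] at hloc
  have := hγloc.comp 𝓘(ℂ, E) _ hloc
  have hcomp : proj Γ ∘ γ = proj Γ := funext fun y => proj_apply Γ hγ y
  rwa [hcomp] at this

/-- Around each point, the projection has a holomorphic section `s`, and `s ∘ p` agrees with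
elements of the group near the points of the fibres. -/
theorem localInverse_comp_proj_eventuallyEq {x₀ x : M}
    (hx : proj Γ x ∈ (isLocalDiffeomorph_proj Γ x₀).localInverse.source) :
    ∃ γ ∈ Γ, (isLocalDiffeomorph_proj Γ x₀).localInverse ∘ proj Γ =ᶠ[𝓝 x] γ := by
  set hp := isLocalDiffeomorph_proj Γ x₀
  obtain ⟨γ, hγ, hγx⟩ := exists_apply_eq Γ (hp.localInverse_right_inv hx).symm
  refine ⟨γ, hγ, ?_⟩
  have hmem : γ x ∈ hp.localInverse.target := by
    rw [hγx]
    exact hp.localInverse.map_source hx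
  filter_upwards [γ.continuous.continuousAt.preimage_mem_nhds
    (hp.localInverse.open_target.mem_nhds hmem)] with y hy
  rw [Function.comp_apply, ← proj_apply Γ hγ y]
  exact hp.localInverse_left_inv hy

theorem diffAt_proj_bijective (x : M) : Function.Bijective (diffAt E E (proj Γ) x) :=
  (isLocalDiffeomorph_proj Γ x).diffAt_bijective

/-- Since `p ∘ γ = p`, everything pulled back from the quotient is invariant under `Γ`. -/
theorem formAt_pullback_pullback_proj (T : BilinField E (orbitRel.Quotient Γ M))
    {γ : Biholomorphism E M} (hγ : γ ∈ Γ) (x : M) :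
    formAt (E := E) (pullback (E := E) γ (pullback (E := E) (proj Γ) T)) x =
      formAt (E := E) (pullback (E := E) (proj Γ) T) x := by
  have d1 : MDifferentiableAt 𝓘(ℝ, E) 𝓘(ℝ, E) γ x :=
    (γ.contMDiff.contMDiffAt.real_of_complex).mdifferentiableAt (by simp)
  have d2 : MDifferentiableAt 𝓘(ℝ, E) 𝓘(ℝ, E) (proj Γ) (γ x) :=
    ((isLocalDiffeomorph_proj Γ _).contMDiffAt.real_of_complex).mdifferentiableAt (by simp)
  have hcomp : proj Γ ∘ γ = proj Γ := funext fun y => proj_apply Γ hγ y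
  simp only [formAt_pullback, bilinComp_bilinComp]
  rw [← diffAt_comp d2 d1, hcomp, proj_apply Γ hγ]

/-- A field of bilinear forms on the quotient is determined by its pull-back. -/
theorem bilinComp_diffAt_proj_injective (x : M) {B B' : E →L[ℝ] E →L[ℝ] ℝ}
    (h : bilinComp B (diffAt E E (proj Γ) x) = bilinComp B' (diffAt E E (proj Γ) x)) : B = B' := by
  ext v w
  obtain ⟨v, rfl⟩ := (diffAt_proj_bijective Γ x).2 v
  obtain ⟨w, rfl⟩ := (diffAt_proj_bijective Γ x).2 w
  exact DFunLike.congr_fun (DFunLike.congr_fun h v) w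

theorem contMDiff_of_comp_proj {α : orbitRel.Quotient Γ M → ℝ}
    (h : ContMDiff 𝓘(ℝ, E) 𝓘(ℝ, ℝ) ∞ (α ∘ proj Γ)) : ContMDiff 𝓘(ℝ, E) 𝓘(ℝ, ℝ) ∞ α := by
  intro q
  obtain ⟨x, rfl⟩ := proj_surjective Γ q
  have hp := isLocalDiffeomorph_proj Γ x
  have hs : ContMDiffAt 𝓘(ℝ, E) 𝓘(ℝ, E) ∞ hp.localInverse (proj Γ x) :=
    hp.localInverse_contMDiffAt.real_of_complex.of_le (by simp)
  refine ((h _).comp _ hs).congr_of_eventuallyEq ?_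
  filter_upwards [hp.localInverse_eventuallyEq_right] with y hy
  simp only [Function.comp_apply] at hy ⊢
  rw [hy]
  rfl

end Quotient

set_option synthInstance.maxHeartbeats 200000 in
/-- Gluing of smooth fields of bilinear forms subject to convex conditions. -/
theorem exists_smoothForm_forall_mem_convex {E : Type*} [NormedAddCommGroup E] [NormedSpace ℂ E]
    [FiniteDimensional ℝ E] {N : Type*} [TopologicalSpace N] [ChartedSpace E N]
    [IsManifold 𝓘(ℂ, E) ω N] [T2Space N] [SigmaCompactSpace N]
    (t : N → Set (E →L[ℝ] E →L[ℝ] ℝ)) (ht : ∀ q, Convex ℝ (t q))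
    (hloc : ∀ q, ∃ U ∈ 𝓝 q, ∃ S : BilinField E N, ∀ y ∈ U, SmoothFormAt S y ∧ formAt S y ∈ t y) :
    ∃ T : BilinField E N, ∀ q, SmoothFormAt T q ∧ formAt T q ∈ t q := by
  let t' (q : N) : Set (TangentSpace 𝓘(ℝ, E) q →L[ℝ] TangentSpace 𝓘(ℝ, E) q →L[ℝ] ℝ) := t q
  have ht' (q : N) : Convex ℝ (t' q) := ht q
  obtain ⟨s, hs⟩ := exists_contMDiffSection_forall_mem_convex_of_local (E := E) (M := N) 𝓘(ℝ, E)
    (n := ⊤) (F_fiber := E →L[ℝ] E →L[ℝ] ℝ)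
    (fun q : N => TangentSpace 𝓘(ℝ, E) q →L[ℝ] TangentSpace 𝓘(ℝ, E) q →L[ℝ] ℝ) t' ht' (fun q => by
      obtain ⟨U, hU, S, hS⟩ := hloc q
      exact ⟨U, hU, S, fun y hy =>
        ((contMDiffAt_iff_smoothFormAt S y).2 (hS y hy).1).contMDiffWithinAt,
        fun y hy => (hS y hy).2⟩)
  refine ⟨fun q => s q, fun q => ⟨?_, hs q⟩⟩
  exact (contMDiffAt_iff_smoothFormAt (fun q => s q) q).1 s.contMDiff.contMDiffAt

/-! ### Descent of conformal classes and of Kähler metrics -/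

section Descent

open MulAction

variable {E : Type*} [NormedAddCommGroup E] [NormedSpace ℂ E] [FiniteDimensional ℂ E]
  {M : Type*} [TopologicalSpace M] [T2Space M] [ChartedSpace E M]
  (Γ : Subgroup (Biholomorphism E M)) [IsCancelSMul Γ M] [ProperlyDiscontinuousSMul Γ M]

/-- The bilinear forms at `q` whose pull-backs to the points above `q` are positive multiples of
`T`. -/
def descentSet (T : BilinField E M) (q : orbitRel.Quotient Γ M) : Set (E →L[ℝ] E →L[ℝ] ℝ) :=
  {B | ∀ x, proj Γ x = q → ∃ c : ℝ, 0 < c ∧ bilinComp B (diffAt E E (proj Γ) x) = c • formAt T x}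

theorem convex_descentSet (T : BilinField E M) (q : orbitRel.Quotient Γ M) :
    Convex ℝ (descentSet Γ T q) := by
  intro B hB B' hB' a b ha hb hab x hx
  obtain ⟨c, hc, h⟩ := hB x hx
  obtain ⟨c', hc', h'⟩ := hB' x hx
  refine ⟨a * c + b * c', ?_, ?_⟩
  -- A weight may vanish, but not both, so the combined factor stays positive.
  · rcases ha.eq_or_lt with rfl | ha
    · have : b = 1 := by linarith
      subst this
      simpa using hc'
    · positivity
  · ext v w
    have hv : B (diffAt E E (proj Γ) x v) (diffAt E E (proj Γ) x w) = c * formAt T x v w :=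
      DFunLike.congr_fun (DFunLike.congr_fun h v) w
    have hv' : B' (diffAt E E (proj Γ) x v) (diffAt E E (proj Γ) x w) = c' * formAt T x v w :=
      DFunLike.congr_fun (DFunLike.congr_fun h' v) w
    change a * B (diffAt E E (proj Γ) x v) (diffAt E E (proj Γ) x w) +
      b * B' (diffAt E E (proj Γ) x v) (diffAt E E (proj Γ) x w) = (a * c + b * c') * formAt T x v w
    rw [hv, hv']
    ring

variable [IsManifold 𝓘(ℂ, E) ω M]

/-- Near any `x` above `q`, the local inverse composed with the projection is some `γ ∈ Γ`, and `γ`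
preserves the conformal class. -/
theorem pullback_localInverse_mem_descentSet (gt : HermitianMetric E M)
    (hΓ : ∀ γ ∈ Γ, gt.IsAutomorphism γ) (x₀ : M) {q : orbitRel.Quotient Γ M}
    (hq : q ∈ (isLocalDiffeomorph_proj Γ x₀).localInverse.source) :
    formAt (pullback (E := E) (isLocalDiffeomorph_proj Γ x₀).localInverse gt.form) q ∈
      descentSet Γ gt.form q := by
  rintro x rfl
  set hp := isLocalDiffeomorph_proj Γ x₀
  obtain ⟨γ, hγ, hev⟩ := localInverse_comp_proj_eventuallyEq Γ hq
  obtain ⟨c, hc, h⟩ := ConformalTo.formAt (hΓ γ hγ) x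
  refine ⟨c⁻¹, inv_pos.2 hc, ?_⟩
  rw [h, smul_smul, inv_mul_cancel₀ hc.ne', one_smul]
  have d1 : MDifferentiableAt 𝓘(ℝ, E) 𝓘(ℝ, E) hp.localInverse (proj Γ x) :=
    ((hp.localInverse_contMDiffOn.contMDiffAt
      (hp.localInverse.open_source.mem_nhds hq)).real_of_complex).mdifferentiableAt (by simp)
  have d2 : MDifferentiableAt 𝓘(ℝ, E) 𝓘(ℝ, E) (proj Γ) x :=
    ((isLocalDiffeomorph_proj Γ x).contMDiffAt.real_of_complex).mdifferentiableAt (by simp)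
  rw [formAt_pullback, formAt_pullback, bilinComp_bilinComp, ← diffAt_comp d1 d2,
    diffAt_congr hev, ← hev.eq_of_nhds, Function.comp_apply]

/-- A conformal class preserved by the group contains the pull-back of a Hermitian metric on the
quotient. -/
theorem exists_hermitianMetric_quotient [SecondCountableTopology M] (gt : HermitianMetric E M)
    (hΓ : ∀ γ ∈ Γ, gt.IsAutomorphism γ) :
    ∃ g : HermitianMetric E (orbitRel.Quotient Γ M), ∀ x, ∃ c : ℝ, 0 < c ∧
      formAt (E := E) (pullback (E := E) (proj Γ) g.form) x = c • formAt gt.form x := by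
  have : ProperSpace E := FiniteDimensional.proper ℂ E
  have : FiniteDimensional ℝ E := FiniteDimensional.complexToReal E
  have : LocallyCompactSpace M := ChartedSpace.locallyCompactSpace E M
  -- Second countability and local compactness give the σ-compactness that gluing requires.
  have : SecondCountableTopology (orbitRel.Quotient Γ M) :=
    ContinuousConstSMul.secondCountableTopology
  have : LocallyCompactSpace (orbitRel.Quotient Γ M) := ChartedSpace.locallyCompactSpace E _
  obtain ⟨T, hT⟩ := exists_smoothForm_forall_mem_convex (descentSet Γ gt.form)
    (convex_descentSet Γ gt.form) fun q => by
      obtain ⟨x₀, rfl⟩ := proj_surjective Γ q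
      set hp := isLocalDiffeomorph_proj Γ x₀
      refine ⟨hp.localInverse.source,
        hp.localInverse.open_source.mem_nhds hp.localInverse_mem_source,
        pullback (E := E) hp.localInverse gt.form, fun y hy => ⟨(gt.smoothFormAt _).pullback ?_,
        pullback_localInverse_mem_descentSet Γ gt hΓ x₀ hy⟩⟩
      exact ((hp.localInverse_contMDiffOn.contMDiffAt
        (hp.localInverse.open_source.mem_nhds hy)).real_of_complex).of_le (by simp)
  -- The differential of `p` is bijective, so symmetry, positivity and `J`-invariance of `T` can be
  -- checked on images of tangent vectors upstairs.
  have key (x : M) : ∃ c : ℝ, 0 < c ∧ ∀ v w : E,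
      formAt T (proj Γ x) (diffAt E E (proj Γ) x v) (diffAt E E (proj Γ) x w) =
        c * formAt gt.form x v w := by
    obtain ⟨c, hc, h⟩ := (hT (proj Γ x)).2 x rfl
    exact ⟨c, hc, fun v w => DFunLike.congr_fun (DFunLike.congr_fun h v) w⟩
  refine ⟨HermitianMetric.ofForm T ?_ ?_ ?_ fun q => (hT q).1,
    fun x => (hT (proj Γ x)).2 x rfl⟩
  · intro q v w
    obtain ⟨x, rfl⟩ := proj_surjective Γ q
    obtain ⟨v, rfl⟩ := (diffAt_proj_bijective Γ x).2 v
    obtain ⟨w, rfl⟩ := (diffAt_proj_bijective Γ x).2 w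
    obtain ⟨c, -, h⟩ := key x
    rw [h, h, gt.formAt_symm]
  · intro q v hv
    obtain ⟨x, rfl⟩ := proj_surjective Γ q
    obtain ⟨v, rfl⟩ := (diffAt_proj_bijective Γ x).2 v
    obtain ⟨c, hc, h⟩ := key x
    rw [h]
    refine mul_pos hc (gt.formAt_pos x v ?_)
    rintro rfl
    simp at hv
  · intro q v w
    obtain ⟨x, rfl⟩ := proj_surjective Γ q
    obtain ⟨v, rfl⟩ := (diffAt_proj_bijective Γ x).2 v
    obtain ⟨w, rfl⟩ := (diffAt_proj_bijective Γ x).2 w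
    obtain ⟨c, -, h⟩ := key x
    have d : MDifferentiableAt 𝓘(ℂ, E) 𝓘(ℂ, E) (proj Γ) x :=
      (isLocalDiffeomorph_proj Γ x).contMDiffAt.mdifferentiableAt (by simp)
    rw [← diffAt_smul d, ← diffAt_smul d, h, h, gt.formAt_I]

/-- If `e^f p^* g` is Kähler, then `g` is locally conformal Kähler. -/
theorem isLCK_of_pullback_proj (g : HermitianMetric E (orbitRel.Quotient Γ M))
    (k : HermitianMetric E M) (hk : k.IsKahler)
    (h : ConformalTo (pullback (E := E) (proj Γ) g.form) k.form) : g.IsLCK := by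
  obtain ⟨f, hf, hfk⟩ := h
  intro q₀
  obtain ⟨x₀, rfl⟩ := proj_surjective Γ q₀
  set hp := isLocalDiffeomorph_proj Γ x₀
  have hα : ContMDiffOn 𝓘(ℝ, E) 𝓘(ℝ, ℝ) ∞ (f ∘ hp.localInverse) hp.localInverse.source :=
    fun y hy => ((hf _).comp y (((hp.localInverse_contMDiffOn.contMDiffAt
      (hp.localInverse.open_source.mem_nhds hy)).real_of_complex).of_le
        (by simp))).contMDiffWithinAt
  refine ⟨hp.localInverse.source, hp.localInverse.open_source, hp.localInverse_mem_source,
    f ∘ hp.localInverse, hα, fun q hq => ?_⟩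
  -- The lift is taken in the image of the local section `s`: near it `s ∘ p` is the identity, so
  -- `p^*(e^(f ∘ s) g)` is `k` itself.
  obtain ⟨x, hx, rfl⟩ : ∃ x ∈ hp.localInverse.target, proj Γ x = q :=
    ⟨_, hp.localInverse.map_source hq, hp.localInverse_right_inv hq⟩
  refine (extDerivForm_fundamentalForm_pullback_eq_zero (x := x) (isLocalDiffeomorph_proj Γ)
    ?_ ?_ ?_).1 fun u v w => ?_
  · exact SmoothFormAt.smul (c := fun q => Real.exp ((f ∘ hp.localInverse) q))
      (Real.contDiff_exp.contMDiff.contMDiffAt.comp _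
        (hα.contMDiffAt (hp.localInverse.open_source.mem_nhds hq))) (g.smoothFormAt _)
  · exact fun y v w => congrArg (Real.exp ((f ∘ hp.localInverse) y) * ·) (g.formAt_symm y v w)
  · exact fun y v w => congrArg (Real.exp ((f ∘ hp.localInverse) y) * ·) (g.formAt_I y v w)
  · rw [← hk x u v w]
    refine extDerivForm_fundamentalForm_congr ?_ u v w
    filter_upwards [hp.localInverse.open_target.mem_nhds hx] with y hy
    rw [hfk y]
    change Real.exp (f (hp.localInverse (proj Γ y))) • pullback (E := E) (proj Γ) g.form y = _
    rw [hp.localInverse_left_inv hy]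

/-- A Kähler metric conformal to `p^* g` that is preserved by the group descends. -/
theorem isGCK_of_pullback_proj [Nontrivial E] (g : HermitianMetric E (orbitRel.Quotient Γ M))
    (k : HermitianMetric E M) (hk : k.IsKahler)
    (h : ConformalTo (pullback (E := E) (proj Γ) g.form) k.form)
    (hinv : ∀ γ ∈ Γ, ∀ x, pullback (E := E) γ k.form x = k.form x) : g.IsGCK := by
  obtain ⟨f, hf, hfk⟩ := h
  have hfk' (x : M) : formAt k.form x =
      Real.exp (f x) • formAt (E := E) (pullback (E := E) (proj Γ) g.form) x := hfk x
  obtain ⟨v, hv⟩ := exists_ne (0 : E)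
  have hfγ (γ) (hγ : γ ∈ Γ) (x : M) : f (γ x) = f x := by
    have h1 : bilinComp (formAt k.form (γ x)) (diffAt E E γ x) = formAt k.form x := hinv γ hγ x
    rw [hfk', hfk'] at h1
    have h2 := formAt_pullback_pullback_proj Γ g.form hγ x
    have h3 : Real.exp (f (γ x)) • formAt (E := E) (pullback (E := E) (proj Γ) g.form) x =
        Real.exp (f x) • formAt (E := E) (pullback (E := E) (proj Γ) g.form) x := by
      rw [← h1, ← h2]
      rfl
    have h4 : formAt (E := E) (pullback (E := E) (proj Γ) g.form) x v v ≠ 0 :=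
      ((g.pullback (proj Γ) (isLocalDiffeomorph_proj Γ)).formAt_pos x v hv).ne'
    exact Real.exp_injective (mul_right_cancel₀ h4 (DFunLike.congr_fun (DFunLike.congr_fun h3 v) v))
  -- An arbitrary choice of lifts suffices because `f` is constant on orbits.
  let α : orbitRel.Quotient Γ M → ℝ := fun q => f (Function.surjInv (proj_surjective Γ) q)
  have hα (x : M) : α (proj Γ x) = f x := by
    obtain ⟨γ, hγ, hγx⟩ := exists_apply_eq Γ
      (Function.surjInv_eq (proj_surjective Γ) (proj Γ x)).symm
    simp only [α]
    rw [← hγx, hfγ γ hγ]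
  have hαs : ContMDiff 𝓘(ℝ, E) 𝓘(ℝ, ℝ) ∞ α := by
    refine contMDiff_of_comp_proj Γ ?_
    have : α ∘ proj Γ = f := funext hα
    rwa [this]
  refine ⟨g.expSmul α hαs, fun q => ?_, α, hαs, fun q => rfl⟩
  obtain ⟨x, rfl⟩ := proj_surjective Γ q
  refine (extDerivForm_fundamentalForm_pullback_eq_zero (x := x) (isLocalDiffeomorph_proj Γ)
    ((g.expSmul α hαs).smoothFormAt _) (g.expSmul α hαs).formAt_symm
    (g.expSmul α hαs).formAt_I).1 fun u v w => ?_
  rw [← hk x u v w]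
  refine extDerivForm_fundamentalForm_congr (Filter.Eventually.of_forall fun y => ?_) u v w
  rw [hfk y, ← hα y]
  rfl

/-- If the quotient is globally conformal Kähler, the group consists of isometries. -/
theorem hasDilationFactor_one_of_isGCK [PreconnectedSpace M] (hE : 2 ≤ Module.finrank ℂ E)
    (g : HermitianMetric E (orbitRel.Quotient Γ M)) (hg : g.IsGCK)
    (k : HermitianMetric E M) (hk : k.IsKahler)
    (h : ConformalTo (pullback (E := E) (proj Γ) g.form) k.form) {γ : Biholomorphism E M}
    (hγ : γ ∈ Γ) : k.HasDilationFactor γ 1 := by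
  refine ⟨one_pos, fun x => ?_⟩
  have : Nontrivial E := Module.nontrivial_of_finrank_pos (R := ℂ) (by omega)
  obtain ⟨k', hk', hgk'⟩ := hg
  set kp := k'.pullback (proj Γ) (isLocalDiffeomorph_proj Γ) with hkp
  have hkpK : kp.IsKahler := fun x u v w =>
    (extDerivForm_fundamentalForm_pullback_eq_zero (x := x) (isLocalDiffeomorph_proj Γ)
      (k'.smoothFormAt _) k'.formAt_symm k'.formAt_I).2 (hk' (proj Γ x)) u v w
  have hconf : ConformalTo k.form kp.form := by
    refine conformalTo_of_formAt _ _ fun x => ?_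
    obtain ⟨a, -, h1⟩ := hgk'.formAt (proj Γ x)
    obtain ⟨b, hb, h2⟩ := h.formAt x
    refine ⟨a * b⁻¹, ?_⟩
    rw [h2, smul_smul, mul_assoc, inv_mul_cancel₀ hb.ne', mul_one]
    change bilinComp (formAt k'.form (proj Γ x)) (diffAt E E (proj Γ) x) = _
    rw [h1]
    rfl
  obtain ⟨α, hα, hαk⟩ := hconf
  have hαk' (x : M) : formAt kp.form x = Real.exp (α x) • formAt k.form x := hαk x
  -- Now `p^*k'` is a constant multiple of `k`; the constant cancels from the invariance of `p^*k'`
  -- under `γ`.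
  have hconst := exp_eq_of_isKahler hE hk hkpK hα hαk
  have h1 : bilinComp (formAt kp.form (γ x)) (diffAt E E γ x) = formAt kp.form x :=
    formAt_pullback_pullback_proj Γ k'.form hγ x
  rw [hαk', hαk', hconst (γ x) x] at h1
  have h2 : Real.exp (α x) • bilinComp (formAt k.form (γ x)) (diffAt E E γ x) =
    Real.exp (α x) • formAt k.form x := h1
  rw [one_smul]
  exact smul_right_injective _ (Real.exp_pos (α x)).ne' h2

end Descent

end LCK

end

/-! ### The main theorem -/

theorem mainTheorem9 {E : Type*} [NormedAddCommGroup E] [NormedSpace ℂ E] [FiniteDimensional ℂ E]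
    (hE : 2 ≤ Module.finrank ℂ E)
    {M : Type*} [TopologicalSpace M] [T2Space M] [SecondCountableTopology M]
    [ChartedSpace E M] [IsManifold 𝓘(ℂ, E) ω M]
    (gt : HermitianMetric E M) (hgt : gt.IsGCK)
    (Γ : Subgroup (Biholomorphism E M)) (hΓ : ∀ γ ∈ Γ, gt.IsAutomorphism γ)
    [IsCancelSMul Γ M] [ProperlyDiscontinuousSMul Γ M] :
    (T2Space (MulAction.orbitRel.Quotient Γ M) ∧
      SecondCountableTopology (MulAction.orbitRel.Quotient Γ M) ∧
      IsLocalDiffeomorph 𝓘(ℂ, E) 𝓘(ℂ, E) ω (proj Γ)) ∧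
    ∃ g : HermitianMetric E (MulAction.orbitRel.Quotient Γ M),
      g.IsLCK ∧ ConformalTo (pullback (proj Γ) g.form) gt.form ∧
      (∀ g' : HermitianMetric E (MulAction.orbitRel.Quotient Γ M),
        ConformalTo (pullback (proj Γ) g'.form) gt.form → ConformalTo g.form g'.form) ∧
      (ConnectedSpace M →
        ∀ k : HermitianMetric E M, k.IsKahler → ConformalTo gt.form k.form →
          (∀ γ ∈ Γ, k.IsHomothety γ) →
          (g.IsGCK ↔ ∀ γ ∈ Γ, k.dilationFactor γ = 1)) := by
  have : ProperSpace E := FiniteDimensional.proper ℂ E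
  have : LocallyCompactSpace M := ChartedSpace.locallyCompactSpace E M
  have : Nontrivial E := Module.nontrivial_of_finrank_pos (R := ℂ) (by omega)
  refine ⟨⟨inferInstance, ContinuousConstSMul.secondCountableTopology,
    isLocalDiffeomorph_proj Γ⟩, ?_⟩
  obtain ⟨g, hg⟩ := exists_hermitianMetric_quotient Γ gt hΓ
  have hconf (k : HermitianMetric E M) (hk : ConformalTo gt.form k.form) :
      ConformalTo (pullback (proj Γ) g.form) k.form := by
    refine conformalTo_of_formAt (g.pullback (proj Γ) (isLocalDiffeomorph_proj Γ)) k fun x => ?_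
    obtain ⟨c, hc, h⟩ := hg x
    obtain ⟨d, -, h'⟩ := hk.formAt x
    -- Here `p^*g = c gt` and `k = d gt` at `x`.
    refine ⟨d * c⁻¹, ?_⟩
    change _ = _ • formAt (E := E) (pullback (E := E) (proj Γ) g.form) x
    rw [h, h', smul_smul, mul_assoc, inv_mul_cancel₀ hc.ne', mul_one]
  have hrefl : ConformalTo gt.form gt.form :=
    conformalTo_of_formAt gt gt fun x => ⟨1, (one_smul _ _).symm⟩
  refine ⟨g, ?_, hconf gt hrefl, fun g' hg' => ?_, fun _ k hk hgk hhom => ⟨fun h γ hγ => ?_,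
    fun h => ?_⟩⟩
  · obtain ⟨k, hk, hgk⟩ := hgt
    exact isLCK_of_pullback_proj Γ g k hk (hconf k hgk)
  · refine conformalTo_of_formAt g g' fun q => ?_
    obtain ⟨x, rfl⟩ := proj_surjective Γ q
    obtain ⟨c, hc, h⟩ := hg x
    obtain ⟨d, hd, h'⟩ := hg'.formAt x
    -- At `x`, `p^*g = c gt` and `gt = d p^*g'`.
    refine ⟨d⁻¹ * c⁻¹, bilinComp_diffAt_proj_injective Γ x ?_⟩
    have e1 : bilinComp (formAt g'.form (proj Γ x)) (diffAt E E (proj Γ) x) =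
        d⁻¹ • formAt gt.form x := by
      rw [h', smul_smul, inv_mul_cancel₀ hd.ne', one_smul]
      rfl
    have e2 : bilinComp ((d⁻¹ * c⁻¹) • formAt g.form (proj Γ x)) (diffAt E E (proj Γ) x) =
        (d⁻¹ * c⁻¹) • formAt (E := E) (pullback (E := E) (proj Γ) g.form) x := rfl
    rw [e1, e2, h, smul_smul, mul_assoc, inv_mul_cancel₀ hc.ne', mul_one]
  · exact (hasDilationFactor_one_of_isGCK Γ hE g h k hk (hconf k hgk) hγ).dilationFactor_eq
  · refine isGCK_of_pullback_proj Γ g k hk (hconf k hgk) fun γ hγ x => ?_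
    -- The homothety hypothesis rules out the default value 1 of `dilationFactor`, so the equation
    -- `h γ hγ` really says that `γ` is an isometry of `k`.
    obtain ⟨c, hc⟩ := hhom γ hγ
    have h1 := h γ hγ
    rw [hc.dilationFactor_eq] at h1
    rw [hc.2 x, h1, one_smul]
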